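/- **Setting.** Let $\mathcal B$ be a unital $C^*$-algebra, $\mathcal A\supseteq\mathcal B$ a unital $C^*$-algebra and $E:\mathcal A\to\mathcal B$ a conditional expectation. Given self-adjoint $\lambda_1,\lambda_2,\ldots\in\mathcal B$ and completely positive maps $\alpha_1,\alpha_2,\ldots:\mathcal B\to\mathcal B$, the *Jacobi–Szegő distribution* with these parameters is $\mu[b_0Xb_1X\cdots Xb_n]=\langle 1,(b_0xb_1x\cdots xb_n)1\rangle$, where on $\mathcal B\langle X\rangle$ (with the inner product $\langle b_0X\cdots Xb_n,c_0X\cdots Xc_m\rangle=\delta_{nm}\,b_n^*\alpha_1[b_{n-1}^*\alpha_2[\cdots\alpha_n[b_0^*c_0]c_1\cdots]c_{n-1}]c_n$) one puts $x=a^*+p+a$ with $a^*(b_0X\cdots Xb_n)=Xb_0X\cdots Xb_n$, $p(b_0X\cdots Xb_n)=\lambda_{n+1}b_0X\cdots Xb_n$, $a(b_0Xb_1X\cdots Xb_n)=\alpha_n[b_0]b_1X\cdots Xb_n$, $a(b_0)=0$. It is of *depth $k$* if $\lambda_i=0$ for $i>k$ and $\alpha_i=0$ for $i\ge k$. Let $\mathcal{TCNC}_{1,2}(d)$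 be the set of non-crossing partitions of $\{1,\dots,d\}$ into singletons and pairs, each block being coloured blue or red. For $k,\ell\ge1$ let $\mathcal{TCNC}_{1,2}^{k,\ell}(d)$ be the set of those $\pi$ such that, for any $k$ nested blue pairs $(a_i,b_i)\in\pi$, $a_1<\cdots<a_k<b_k<\cdots<b_1$, there is a red pair $(c,e)\in\pi$ with $a_1<c<a_k$ and $b_k<e<b_1$, and the same holds with the colours exchanged and $\ell$ in place of $k$. Let $\mathcal{TCNC}_2^{k,\ell}(d)$ be its subset of partitions without singletons. The relative depth of a block $V$ of $\pi$ is one plus the number of pairs of the colour of $V$ that cover $V$ and lie inside every pair of the other colour covering $V$. Given two sequences of Jacobi parameters, one for blue and one for red, $E_\pi(b_0Xb_1X\cdots Xb_d)$ is obtained by replacing each singleton block by a $\lambda$ and each pair by the application of an $\alpha$ to the terms between its ends, the parameters being those of the colour of the block, with the relative depth of the block as index. **Statement.** Let $k,\ell\ge1$. (1) Let $X_1,X_2\in\mathcal A$ be self-adjoint, free over $\mathcal B$, with Jacobi–Szegő distributions of depths $k$ and $\ell$. Then for all $d$, all $\epsilon_1,\dots,\epsilon_d\in\{1,2\}$ and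 all $b_0,\dots,b_d\in\mathcal B$, $$E(b_0X_{\epsilon_1}b_1X_{\epsilon_2}\cdots X_{\epsilon_d}b_d)=\sum_\pi E_\pi(b_0X_{\epsilon_1}b_1X_{\epsilon_2}\cdots X_{\epsilon_d}b_d),$$ where $\pi$ runs over those elements of $\mathcal{TCNC}_{1,2}^{k,\ell}(d)$ whose blue blocks consist of positions $i$ with $\epsilon_i=1$ and whose red blocks consist of positions $i$ with $\epsilon_i=2$; the sum over all such $\pi\in\mathcal{TCNC}_{1,2}(d)$ has the same value. (2) Let $\nu_k$ be the distribution of the matrix $\sum_{i=1}^{k-1}(e_{i,i+1}+e_{i+1,i})\in M_k(\mathbb C)$ with respect to the functional that takes the $(1,1)$ entry (so $\nu_1=\delta_0$). The free convolution $\nu_k\boxplus\nu_\ell$ (the distribution of the sum of two free self-adjoint random variables with distributions $\nu_k$, $\nu_\ell$) exists, and for all $n\ge0$ $$|\mathcal{TCNC}_2^{k,\ell}(2n)|=\int t^{2n}\,d(\nu_k\boxplus\nu_\ell)(t).$$ -/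

import Mathlib

universe u v

/-! ## Two-colour non-crossing partitions into singletons and pairs -/

/-- A two-colour non-crossing partition of a `d`-element ordered set into blocks of size at most
two. The block of `i` is `{i, mate i}`, so that singletons are the fixed points of `mate`. Colour
`0` is blue (the colour of the first variable), colour `1` is red (the second variable). -/
@[ext]
structure TCNC (d : ℕ) where
  mate : Fin d → Fin d
  color : Fin d → Fin 2
  mate_mate : ∀ i, mate (mate i) = i
  color_mate : ∀ i, color (mate i) = color i
  noncrossing : ∀ i j, ¬ (i < j ∧ j < mate i ∧ mate i < mate j)

namespace TCNC

variable {d : ℕ}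

noncomputable instance : Fintype (TCNC d) :=
  Fintype.ofInjective (fun π : TCNC d => (π.mate, π.color)) (by
    intro π σ h
    simp only [Prod.mk.injEq] at h
    exact TCNC.ext h.1 h.2)

/-- `a` is the left end of a pair of colour `c`. -/
def IsPair (π : TCNC d) (c : Fin 2) (a : Fin d) : Prop :=
  π.color a = c ∧ a < π.mate a

/-- The pair with left end `a` covers the point `i` strictly. -/
def Covers (π : TCNC d) (a i : Fin d) : Prop :=
  a < i ∧ i < π.mate a

/-- The relative depth of `i`: one plus the number of pairs of the same colour which cover `i` and
lie inside every pair of the opposite colour that covers `i`. -/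
noncomputable def depth (π : TCNC d) (i : Fin d) : ℕ :=
  1 + Set.ncard {a : Fin d | π.IsPair (π.color i) a ∧ π.Covers a i ∧
    ∀ r c, c ≠ π.color i → π.IsPair c r → π.Covers r i → r < a}

/-- Any `k` nested pairs of colour `c` have a pair of the other colour strictly between the
outermost and the innermost of them (`f` lists the left ends, `k ≥ 1`). -/
def DepthLT (π : TCNC d) (c : Fin 2) (k : ℕ) : Prop :=
  ∀ (hk : 0 < k) (f : Fin k → Fin d), StrictMono f → StrictAnti (fun i => π.mate (f i)) →
    (∀ i, π.IsPair c (f i)) →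
    ∃ r c', c' ≠ c ∧ π.IsPair c' r ∧
      f ⟨0, hk⟩ < r ∧ r < f ⟨k - 1, Nat.sub_lt hk one_pos⟩ ∧
      π.mate (f ⟨k - 1, Nat.sub_lt hk one_pos⟩) < π.mate r ∧ π.mate r < π.mate (f ⟨0, hk⟩)

open Classical in
/-- The two-colour non-crossing partitions into singletons and pairs of relative depths `k` (blue)
and `l` (red). -/
noncomputable def relDepth (k l d : ℕ) : Finset (TCNC d) :=
  Finset.univ.filter fun π => π.DepthLT 0 k ∧ π.DepthLT 1 l

/-- The two-colour non-crossing pairings (no singletons) of relative depths `k` and `l`. -/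
noncomputable def pairings (k l d : ℕ) : Finset (TCNC d) :=
  (relDepth k l d).filter fun π => ∀ i, π.mate i ≠ i

end TCNC

/-! ## Jacobi parameters and Jacobi–Szegő distributions -/

/-- Operator-valued Jacobi parameters: self-adjoint `lam 1, lam 2, …` and completely positive
`alpha 1, alpha 2, …`. The entries with index `0` are never used. -/
structure JacobiParams (B : Type v) [CStarAlgebra B] [PartialOrder B] [StarOrderedRing B] where
  lam : ℕ → B
  alpha : ℕ → CompletelyPositiveMap B B
  isSelfAdjoint_lam : ∀ i, IsSelfAdjoint (lam i)

/-- The monomial `b 0 * X 0 * b 1 * X 1 * ⋯ * X (d - 1) * b d`, the coefficients being inserted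
through `ι`. -/
def ncMonomial {B : Type*} {M : Type*} [Monoid M] (ι : B → M) {d : ℕ} (X : Fin d → M)
    (b : ℕ → B) : M :=
  ι (b 0) * (List.ofFn fun i : Fin d => X i * ι (b (i + 1))).prod

/-- The complex vector space spanned by the words `b₀ X b₁ X ⋯ X bₙ`; such a word is
`(b₀, [b₁, …, bₙ])`. Multilinearity in the `bᵢ` need not be imposed: it holds modulo the null
space of the (in any case possibly degenerate) inner product `JacobiParams.inner`. -/
abbrev WordSpace (B : Type v) : Type v := (B × List B) →₀ ℂ

namespace WordSpace

/-- Left multiplication by `b`. -/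
noncomputable def leftMul {B : Type v} [Mul B] (b : B) : Module.End ℂ (WordSpace B) :=
  Finsupp.linearCombination ℂ fun w => Finsupp.single (b * w.1, w.2) 1

end WordSpace

namespace JacobiParams

variable {B : Type v} [CStarAlgebra B] [PartialOrder B] [StarOrderedRing B]

/-- Helper for `wordInner`: `acc` is the part of the nested expression already evaluated. -/
noncomputable def wordInnerAux (J : JacobiParams B) : B → List B → List B → B
  | acc, [], [] => acc
  | acc, b :: bs, c :: cs => J.wordInnerAux (star b * J.alpha (bs.length + 1) acc * c) bs cs
  | _, _, _ => 0

/-- The `B`-valued inner product of two words: it is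
`bₙ* α₁[bₙ₋₁* α₂[⋯ αₙ[b₀* c₀] c₁ ⋯] cₙ₋₁] cₙ` for words of the same degree, and `0` otherwise. -/
noncomputable def wordInner (J : JacobiParams B) (w w' : B × List B) : B :=
  J.wordInnerAux (star w.1 * w'.1) w.2 w'.2

/-- The sesquilinear extension of `wordInner`. -/
noncomputable def inner (J : JacobiParams B) (ξ η : WordSpace B) : B :=
  ξ.sum fun w z => η.sum fun w' z' => (star z * z') • J.wordInner w w'

/-- `a*(b₀ X ⋯ X bₙ) = X b₀ X ⋯ X bₙ`. -/
noncomputable def create : Module.End ℂ (WordSpace B) :=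
  Finsupp.linearCombination ℂ fun w => Finsupp.single (1, w.1 :: w.2) 1

/-- `p(b₀ X ⋯ X bₙ) = λₙ₊₁ b₀ X ⋯ X bₙ`. -/
noncomputable def preserve (J : JacobiParams B) : Module.End ℂ (WordSpace B) :=
  Finsupp.linearCombination ℂ fun w => Finsupp.single (J.lam (w.2.length + 1) * w.1, w.2) 1

/-- `a(b₀ X b₁ X ⋯ X bₙ) = αₙ[b₀] b₁ X ⋯ X bₙ` and `a(b₀) = 0`. -/
noncomputable def annihilate (J : JacobiParams B) : Module.End ℂ (WordSpace B) :=
  Finsupp.linearCombination ℂ fun w =>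
    match w with
    | (_, []) => 0
    | (b₀, b₁ :: bs) => Finsupp.single (J.alpha (bs.length + 1) b₀ * b₁, bs) 1

/-- The operator `x = a* + p + a`. -/
noncomputable def op (J : JacobiParams B) : Module.End ℂ (WordSpace B) :=
  create + J.preserve + J.annihilate

/-- The Jacobi–Szegő distribution with parameters `J`, evaluated at `b 0 X b 1 X ⋯ X b n`:
the value `⟨1, (b 0 x b 1 x ⋯ x b n) 1⟩`. -/
noncomputable def distr (J : JacobiParams B) (n : ℕ) (b : ℕ → B) : B :=
  J.inner (Finsupp.single (1, []) 1)
    (ncMonomial WordSpace.leftMul (fun _ : Fin n => J.op) b (Finsupp.single (1, []) 1))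

/-- Depth `k`: all parameters after `lam k` and `alpha (k - 1)` vanish. -/
def HasDepth (J : JacobiParams B) (k : ℕ) : Prop :=
  (∀ i, k < i → J.lam i = 0) ∧ ∀ i, k ≤ i → ∀ b, J.alpha i b = 0

end JacobiParams

/-! ## The moment attached to a two-colour partition -/

namespace TCNC

variable {B : Type v} [CStarAlgebra B] [PartialOrder B] [StarOrderedRing B] {d : ℕ}

/-- The value of the segment `b i X_i b (i+1) X_{i+1} ⋯ X_{j-1} b j` (positions start at `0`): a
singleton is replaced by a `lam`, a pair by the application of an `alpha` to the terms between its
two ends; the parameters are those of the colour of the block, with the relative depth of the block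
as index. (The last `0` is never reached, the partition being non-crossing.) -/
noncomputable def segment (π : TCNC d) (J : Fin 2 → JacobiParams B) (b : ℕ → B) (i j : ℕ) : B :=
  if h : i < j ∧ i < d then
    let s : Fin d := ⟨i, h.2⟩
    let m : ℕ := π.mate s
    if m = i then
      b i * (J (π.color s)).lam (π.depth s) * π.segment J b (i + 1) j
    else if i < m ∧ m < j then
      b i * (J (π.color s)).alpha (π.depth s) (π.segment J b (i + 1) m)
        * π.segment J b (m + 1) j
    else 0
  else b i
termination_by j - i
decreasing_by
  all_goals simp only [m, s] at *
  all_goals omega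

/-- The moment `E_π(b 0 X b 1 X ⋯ X b d)` calculated according to `π`. -/
noncomputable def moment (π : TCNC d) (J : Fin 2 → JacobiParams B) (b : ℕ → B) : B :=
  π.segment J b 0 d

end TCNC

/-! ## Operator-valued probability spaces and freeness -/

/-- `E` is a conditional expectation of the unital C⋆-algebra `A` onto the unital C⋆-algebra `B`,
which is embedded in `A` through `ι` (injective by `map_incl`). -/
structure IsCondExp {A : Type u} {B : Type v} [CStarAlgebra A] [CStarAlgebra B] [PartialOrder B]
    (ι : B →⋆ₐ[ℂ] A) (E : A →ₗ[ℂ] B) : Prop where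
  map_incl : ∀ b, E (ι b) = b
  map_bimod : ∀ b a b', E (ι b * a * ι b') = b * E a * b'
  map_nonneg : ∀ a, 0 ≤ E (star a * a)

/-- `X 0` and `X 1` are free over `B`: `E (P₁(X_{i₁}) ⋯ Pₙ(X_{iₙ})) = 0`, `n ≥ 1`, whenever
neighbouring indices differ and all `E (Pⱼ(X_{iⱼ})) = 0`. The elements `P(X i)` with
`P ∈ B⟨X⟩` are those of the subalgebra generated by `B` and `X i`. -/
def AreFree {A : Type u} {B : Type v} [CStarAlgebra A] [CStarAlgebra B]
    (ι : B →⋆ₐ[ℂ] A) (E : A →ₗ[ℂ] B) (X : Fin 2 → A) : Prop :=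
  ∀ (n : ℕ) (i : Fin (n + 1) → Fin 2) (a : Fin (n + 1) → A),
    (∀ j, a j ∈ Algebra.adjoin ℂ (Set.range ι ∪ {X (i j)})) →
    (∀ j, E (a j) = 0) →
    (∀ j : Fin n, i j.castSucc ≠ i j.succ) →
    E (List.ofFn a).prod = 0

/-- `X` is a self-adjoint random variable whose distribution is the Jacobi–Szegő distribution with
parameters `J`. -/
def IsJacobiSzego {A : Type u} {B : Type v} [CStarAlgebra A] [CStarAlgebra B] [PartialOrder B]
    [StarOrderedRing B] (ι : B →⋆ₐ[ℂ] A) (E : A →ₗ[ℂ] B) (X : A) (J : JacobiParams B) : Prop :=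
  IsSelfAdjoint X ∧
    ∀ (n : ℕ) (b : ℕ → B), E (ncMonomial ι (fun _ : Fin n => X) b) = J.distr n b

/-! ## Scalar distributions -/

open MeasureTheory

/-- `μ` is the distribution of the (bounded self-adjoint) element `a` with respect to `φ`: a
probability measure on the line with the same moments. -/
def HasDistribution {A : Type u} [CStarAlgebra A] (φ : A →ₗ[ℂ] ℂ) (a : A) (μ : Measure ℝ) : Prop :=
  IsProbabilityMeasure μ ∧
    ∀ n : ℕ, Integrable (fun t : ℝ => t ^ n) μ ∧ φ (a ^ n) = ((∫ t, t ^ n ∂μ : ℝ) : ℂ)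

open scoped ComplexOrder in
/-- `ρ = μ ⊞ ν`: it is the distribution of `X 0 + X 1`, where `X 0`, `X 1` are free self-adjoint
elements, with distributions `μ` and `ν`, of a C⋆-probability space. -/
def IsFreeConvolution (μ ν ρ : Measure ℝ) : Prop :=
  ∃ (A : Type u) (_ : CStarAlgebra A) (φ : A →ₗ[ℂ] ℂ) (X : Fin 2 → A),
    IsCondExp (StarAlgHom.ofId ℂ A) φ ∧ AreFree (StarAlgHom.ofId ℂ A) φ X ∧
    (∀ i, IsSelfAdjoint (X i)) ∧
    HasDistribution φ (X 0) μ ∧ HasDistribution φ (X 1) ν ∧ HasDistribution φ (X 0 + X 1) ρ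

/-- The `k × k` matrix `∑ (e_{i,i+1} + e_{i+1,i})`. -/
def pathMatrix (k : ℕ) : Matrix (Fin k) (Fin k) ℂ :=
  Matrix.of fun i j => if (i : ℕ) + 1 = j ∨ (j : ℕ) + 1 = i then 1 else 0

theorem isHermitian_pathMatrix (k : ℕ) : (pathMatrix k).IsHermitian := by
  ext i j
  simp only [pathMatrix, Matrix.conjTranspose_apply, Matrix.of_apply]
  split_ifs <;> simp_all

/-- The distribution `ν_k` of `pathMatrix k` with respect to the functional "top left entry" (the
vector state of the first basis vector): the spectral measure of the matrix at that vector. -/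
noncomputable def pathMeasure (k : ℕ) : Measure ℝ :=
  ∑ j : Fin k, ENNReal.ofReal
      (‖(isHermitian_pathMatrix k).eigenvectorBasis j ⟨0, j.pos⟩‖ ^ 2) •
    Measure.dirac ((isHermitian_pathMatrix k).eigenvalues j)

/-! ## The sum over all non-crossing partitions of an interval -/

/-! The joint moments are computed on a free Fock space realised by polynomials. To each word in two
colours with coefficients in `B` belongs a Wick product `wick`, defined so that multiplication by `X
c` acts as creation + preservation + annihilation. The index of the Jacobi parameter used is
governed by the run of letters `c` at the head of the word, because a change of colour restarts the
count (`runDepth`).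

The crucial fact is that a Wick product of a nonempty word has expectation zero (`map_wick_cons`).
It factors over the maximal one-coloured runs (`wick_monoWord_append`). Each factor lies in the
algebra of a single variable and is centred, since in the one-variable Jacobi model it sends the
vacuum to a word of positive length (`map_wick_monoWord`). Freeness then kills the alternating
product.

A monomial is therefore expanded from its right end. A letter created at one position must be
annihilated at an earlier position of the same colour, which gives a pair; a preservation gives a
singleton. The resulting partition is non-crossing, and the length of the head run at the moment of
action is the relative depth of the block. The expansion peels off the last block, whereas
`TCNC.segment` peels off the first; `nestedSum` satisfies both recursions (`nestedSum_succ_right`),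
and `TCNC.sum_moment` identifies it with the sum over all partitions. A partition outside
`TCNC.relDepth` has a pair whose depth reaches `k` or `l` (`TCNC.exists_le_depth_of_not_depthLT`),
so its moment vanishes.

For the count, `pathMeasure k` has Jacobi parameters `lam = 0`, `alpha i = id` for `i < k` and
`alpha i = 0` from `k` on. At coefficients `1` a partition in `relDepth` thus contributes `1` if it
has no singletons and `0` otherwise; expanding the power of `X 0 + X 1` over colourings counts the
pairings. The free convolution is realised by truncated creation and annihilation operators on `ℓ²`
of the words in two letters (`areFree_fockVar`), with the distribution of the sum obtained from the
Riesz representation theorem (`exists_hasDistribution`). -/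

/-- The depths of the outer blocks of either colour inside a pair of colour `c`, if `D` gives the
depths of the blocks at the level of that pair. -/
def innerDepth (D : Fin 2 → ℕ) (c : Fin 2) : Fin 2 → ℕ :=
  fun c' => if c = c' then D c + 1 else 1

section NestedSum

variable {B : Type v} [CStarAlgebra B] [PartialOrder B] [StarOrderedRing B]
variable (J : Fin 2 → JacobiParams B) (ε : ℕ → Fin 2) (b : ℕ → B)

/-- The sum of the values of the segment `[i, j)` over all non-crossing partitions with colours
`ε`, where the outer blocks have depths `D` and the last coefficient is `β`. -/
noncomputable def nestedSum (D : Fin 2 → ℕ) (i j : ℕ) (β : B) : B :=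
  if i < j then
    b i * (J (ε i)).lam (D (ε i)) * nestedSum D (i + 1) j β +
      ∑ m ∈ (Finset.Ioo i j).attach, if ε m = ε i then
        b i * (J (ε i)).alpha (D (ε i)) (nestedSum (innerDepth D (ε i)) (i + 1) m (b m)) *
          nestedSum D (m + 1) j β
      else 0
  else β
termination_by j - i
decreasing_by
  · omega
  · have := Finset.mem_Ioo.1 m.2; omega
  · have := Finset.mem_Ioo.1 m.2; omega

theorem nestedSum_self (D : Fin 2 → ℕ) (i : ℕ) (β : B) : nestedSum J ε b D i i β = β := by
  rw [nestedSum, if_neg (lt_irrefl i)]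

theorem nestedSum_of_lt (D : Fin 2 → ℕ) {i j : ℕ} (h : i < j) (β : B) :
    nestedSum J ε b D i j β =
      b i * (J (ε i)).lam (D (ε i)) * nestedSum J ε b D (i + 1) j β +
      ∑ m ∈ Finset.Ioo i j, if ε m = ε i then
        b i * (J (ε i)).alpha (D (ε i)) (nestedSum J ε b (innerDepth D (ε i)) (i + 1) m (b m)) *
          nestedSum J ε b D (m + 1) j β
      else 0 := by
  rw [nestedSum, if_pos h, ← Finset.sum_attach (Finset.Ioo i j)]

theorem sum_Ioo_succ_right {M : Type*} [AddCommMonoid M] (f : ℕ → M) {i j : ℕ} (h : i < j) :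
    ∑ m ∈ Finset.Ioo i (j + 1), f m = ∑ m ∈ Finset.Ioo i j, f m + f j := by
  have : Finset.Ioo i (j + 1) = insert j (Finset.Ioo i j) := by
    ext x; simp only [Finset.mem_Ioo, Finset.mem_insert]; omega
  rw [this, Finset.sum_insert (by simp), add_comm]

/-- Splitting off the last block instead of the first one. -/
theorem nestedSum_succ_right (D : Fin 2 → ℕ) {i j : ℕ} (h : i ≤ j) (β : B) :
    nestedSum J ε b D i (j + 1) β =
      nestedSum J ε b D i j (b j * (J (ε j)).lam (D (ε j)) * β) +
      ∑ q ∈ Finset.Ico i j, if ε q = ε j then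
        nestedSum J ε b D i q (b q * (J (ε j)).alpha (D (ε j))
          (nestedSum J ε b (innerDepth D (ε j)) (q + 1) j (b j)) * β)
      else 0 := by
  obtain ⟨n, hn⟩ : ∃ n, n = j - i := ⟨_, rfl⟩
  induction n using Nat.strong_induction_on generalizing i with
  | _ n ih =>
  rcases h.eq_or_lt with rfl | hij
  · rw [nestedSum_of_lt _ _ _ _ (Nat.lt_succ_self _)]
    have : Finset.Ioo i (i + 1) = ∅ := by ext x; simp
    simp [nestedSum_self, this]
  · have key : ∀ m, i ≤ m → m < j → nestedSum J ε b D (m + 1) (j + 1) β = _ :=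
      fun m h1 h2 => ih (j - (m + 1)) (by omega) (i := m + 1) (by omega) rfl
    rw [nestedSum_of_lt _ _ _ _ (by omega : i < j + 1), key i le_rfl hij,
      sum_Ioo_succ_right _ hij, nestedSum_of_lt _ _ _ _ hij]
    rw [← Finset.sum_Ioo_add_eq_sum_Ico hij, nestedSum_self, nestedSum_self]
    have e1 : ∀ m ∈ Finset.Ioo i j, (if ε m = ε i then
        b i * (J (ε i)).alpha (D (ε i)) (nestedSum J ε b (innerDepth D (ε i)) (i + 1) m (b m)) *
          nestedSum J ε b D (m + 1) (j + 1) β else 0) =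
        (if ε m = ε i then
        b i * (J (ε i)).alpha (D (ε i)) (nestedSum J ε b (innerDepth D (ε i)) (i + 1) m (b m)) *
          nestedSum J ε b D (m + 1) j (b j * (J (ε j)).lam (D (ε j)) * β) else 0) +
        ∑ q ∈ Finset.Ico (m + 1) j, if ε m = ε i then (if ε q = ε j then
        b i * (J (ε i)).alpha (D (ε i)) (nestedSum J ε b (innerDepth D (ε i)) (i + 1) m (b m)) *
          nestedSum J ε b D (m + 1) q (b q * (J (ε j)).alpha (D (ε j))
          (nestedSum J ε b (innerDepth D (ε j)) (q + 1) j (b j)) * β) else 0) else 0 := by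
      intro m hm
      have hm' := Finset.mem_Ioo.1 hm
      split_ifs with h1
      · rw [key m hm'.1.le hm'.2, mul_add, Finset.mul_sum]
        congr 1
        exact Finset.sum_congr rfl fun q _ => by split_ifs <;> simp
      · simp
    have e2 : ∀ q ∈ Finset.Ioo i j, (if ε q = ε j then
        nestedSum J ε b D i q (b q * (J (ε j)).alpha (D (ε j))
          (nestedSum J ε b (innerDepth D (ε j)) (q + 1) j (b j)) * β) else 0) =
        (if ε q = ε j then b i * (J (ε i)).lam (D (ε i)) *
          nestedSum J ε b D (i + 1) q (b q * (J (ε j)).alpha (D (ε j))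
          (nestedSum J ε b (innerDepth D (ε j)) (q + 1) j (b j)) * β) else 0) +
        ∑ m ∈ Finset.Ioo i q, if ε m = ε i then (if ε q = ε j then
        b i * (J (ε i)).alpha (D (ε i)) (nestedSum J ε b (innerDepth D (ε i)) (i + 1) m (b m)) *
          nestedSum J ε b D (m + 1) q (b q * (J (ε j)).alpha (D (ε j))
          (nestedSum J ε b (innerDepth D (ε j)) (q + 1) j (b j)) * β) else 0) else 0 := by
      intro q hq
      split_ifs with h1
      · rw [nestedSum_of_lt _ _ _ _ (Finset.mem_Ioo.1 hq).1]
      · simp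
    rw [Finset.sum_congr rfl e1, Finset.sum_congr rfl e2, Finset.sum_add_distrib,
      Finset.sum_add_distrib]
    -- Partitions whose first block `{i, m}` and last block `{q, j}` are distinct pairs with `m <
    -- q`: one side fixes `m` first, the other `q`.
    have e3 := Finset.sum_comm' (s := Finset.Ioo i j) (t := fun m => Finset.Ico (m + 1) j)
      (t' := Finset.Ioo i j) (s' := fun q => Finset.Ioo i q)
      (by intro x y; simp only [Finset.mem_Ioo, Finset.mem_Ico]; omega)
      (f := fun m q => if ε m = ε i then (if ε q = ε j then
        b i * (J (ε i)).alpha (D (ε i)) (nestedSum J ε b (innerDepth D (ε i)) (i + 1) m (b m)) *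
          nestedSum J ε b D (m + 1) q (b q * (J (ε j)).alpha (D (ε j))
          (nestedSum J ε b (innerDepth D (ε j)) (q + 1) j (b j)) * β) else 0) else 0)
    rw [e3, mul_add, Finset.mul_sum]
    -- The pair joining `i` to `j` is at once the first and the last block.
    have e4 : (if ε j = ε i then b i * (J (ε i)).alpha (D (ε i))
        (nestedSum J ε b (innerDepth D (ε i)) (i + 1) j (b j)) * β else 0) =
        if ε i = ε j then b i * (J (ε j)).alpha (D (ε j))
        (nestedSum J ε b (innerDepth D (ε j)) (i + 1) j (b j)) * β else 0 := by
      by_cases h : ε i = ε j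
      · simp [h]
      · simp [h, Ne.symm h]
    rw [e4]
    have e5 : ∑ q ∈ Finset.Ico (i + 1) j, b i * (J (ε i)).lam (D (ε i)) * (if ε q = ε j then
          nestedSum J ε b D (i + 1) q (b q * (J (ε j)).alpha (D (ε j))
          (nestedSum J ε b (innerDepth D (ε j)) (q + 1) j (b j)) * β) else 0) =
        ∑ q ∈ Finset.Ioo i j, (if ε q = ε j then b i * (J (ε i)).lam (D (ε i)) *
          nestedSum J ε b D (i + 1) q (b q * (J (ε j)).alpha (D (ε j))
          (nestedSum J ε b (innerDepth D (ε j)) (q + 1) j (b j)) * β) else 0) := by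
      refine Finset.sum_congr rfl fun q _ => ?_
      split_ifs <;> simp
    rw [e5]
    abel

end NestedSum

/-! ### Enumeration of the partitions of an interval through mate functions. -/

/-- `f` is the mate function of a non-crossing partition into singletons and pairs, compatible with
the colours `ε`, all of whose pairs lie in `[i, j)`. -/
structure IsMate (ε : ℕ → Fin 2) (i j : ℕ) (f : ℕ → ℕ) : Prop where
  invol : ∀ x, f (f x) = x
  color : ∀ x, ε (f x) = ε x
  outside : ∀ x, x < i ∨ j ≤ x → f x = x
  noncrossing : ∀ x y, ¬ (x < y ∧ y < f x ∧ f x < f y)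

namespace IsMate

variable {ε : ℕ → Fin 2} {i j m : ℕ} {f g h : ℕ → ℕ}

theorem le_apply (hf : IsMate ε i j f) {x : ℕ} (hx : i ≤ x) : i ≤ f x := by
  by_contra hlt
  have := hf.outside (f x) (Or.inl (by omega))
  rw [hf.invol] at this
  omega

theorem apply_lt (hf : IsMate ε i j f) {x : ℕ} (hx : x < j) : f x < j := by
  by_contra hlt
  have := hf.outside (f x) (Or.inr (by omega))
  rw [hf.invol] at this
  omega

/-- The partition consisting of the pair `{i, m}`, of `g` inside and of `h` to the right of it. -/
def glue (i m : ℕ) (g h : ℕ → ℕ) (x : ℕ) : ℕ :=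
  if x = i then m else if x = m then i else if x < m then g x else h x

theorem glue_isMate (him : i < m) (hmj : m < j) (hε : ε m = ε i) (hg : IsMate ε (i + 1) m g)
    (hh : IsMate ε (m + 1) j h) : IsMate ε i j (glue i m g h) := by
  have hg1 : ∀ x, i < x → i < g x := fun x hx => hg.le_apply hx
  have hg2 : ∀ x, x < m → g x < m := fun x hx => hg.apply_lt hx
  have hh1 : ∀ x, m < x → m < h x := fun x hx => hh.le_apply hx
  have hh2 : ∀ x, x < j → h x < j := fun x hx => hh.apply_lt hx
  have hg3 : ∀ x, x < i → g x = x := fun x hx => hg.outside x (Or.inl (by omega))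
  have hh3 : ∀ x, j ≤ x → h x = x := fun x hx => hh.outside x (Or.inr (by omega))
  refine ⟨fun x => ?_, fun x => ?_, fun x hx => ?_, fun x y => ?_⟩
  · have := hg.invol x
    have := hh.invol x
    have := hg1 x
    have := hg2 x
    have := hh1 x
    have := hg3 x
    unfold glue
    grind
  · have := hg.color x
    have := hh.color x
    unfold glue
    grind
  · have := hg3 x
    have := hh3 x
    unfold glue
    grind
  · have := hg.noncrossing x y
    have := hh.noncrossing x y
    have := hg1 x
    have := hg1 y
    have := hg2 x
    have := hg2 y
    have := hh1 x
    have := hh1 y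
    have := hg3 x
    have := hg3 y
    unfold glue
    grind

theorem inside_isMate (hf : IsMate ε i j f) (him : i < f i) :
    IsMate ε (i + 1) (f i) (fun x => if i < x ∧ x < f i then f x else x) := by
  have h0 := hf.invol i
  have h1 : ∀ x, i < x → x < f i → i < f x ∧ f x < f i := by
    intro x hx hx'
    have a1 := hf.noncrossing i x
    have a2 : f x ≠ f i := fun h => by have := congrArg f h; rw [hf.invol, hf.invol] at this; omega
    have a3 := hf.invol x
    have a4 : f x ≠ i := fun h => by rw [h] at a3; omega
    have a5 := hf.noncrossing (f x) i
    rw [a3] at a5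
    omega
  refine ⟨fun x => ?_, fun x => ?_, fun x hx => ?_, fun x y => ?_⟩
  · have := hf.invol x
    have := h1 x
    grind
  · have := hf.color x
    grind
  · grind
  · have := hf.noncrossing x y
    have := h1 x
    have := h1 y
    grind

theorem right_isMate (hf : IsMate ε i j f) (him : i < f i) :
    IsMate ε (f i + 1) j (fun x => if f i < x then f x else x) := by
  have h0 := hf.invol i
  have h1 : ∀ x, f i < x → f i < f x := by
    intro x hx
    have a3 := hf.invol x
    by_contra hlt
    rcases lt_or_ge (f x) i with h | h
    · have := hf.outside _ (Or.inl h); omega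
    have a2 : f x ≠ f i := fun h => by have := congrArg f h; rw [hf.invol, hf.invol] at this; omega
    have a4 : f x ≠ i := fun h => by rw [h] at a3; omega
    have a5 := hf.noncrossing i (f x)
    rw [a3] at a5
    omega
  refine ⟨fun x => ?_, fun x => ?_, fun x hx => ?_, fun x y => ?_⟩
  · have := hf.invol x
    have := h1 x
    grind
  · have := hf.color x
    grind
  · have := hf.outside x
    grind
  · have := hf.noncrossing x y
    have := h1 x
    have := h1 y
    grind

theorem of_fixed (hf : IsMate ε i j f) (hi : f i = i) : IsMate ε (i + 1) j f :=
  ⟨hf.invol, hf.color, fun x hx => by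
    rcases eq_or_ne x i with rfl | h
    · exact hi
    · exact hf.outside x (by omega), hf.noncrossing⟩

theorem mono (hf : IsMate ε (i + 1) j f) : IsMate ε i j f ∧ f i = i :=
  ⟨⟨hf.invol, hf.color, fun x hx => hf.outside x (by omega), hf.noncrossing⟩,
    hf.outside i (Or.inl (by omega))⟩

theorem glue_split (hf : IsMate ε i j f) :
    glue i (f i) (fun x => if i < x ∧ x < f i then f x else x)
      (fun x => if f i < x then f x else x) = f := by
  funext x
  have h0 := hf.invol i
  have := hf.outside x
  simp only [glue]
  grind

theorem finite_setOf (ε : ℕ → Fin 2) (i j : ℕ) : {f | IsMate ε i j f}.Finite := by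
  refine Set.Finite.of_injOn (t := Set.univ)
    -- The default `x` is never taken, since a mate function maps the numbers below `j` to
    -- themselves.
    (f := fun f (x : Fin j) => if h : f x < j then (⟨f x, h⟩ : Fin j) else x)
    (fun _ _ => Set.mem_univ _) ?_ Set.finite_univ
  intro f hf g hg hfg
  funext x
  rcases lt_or_ge x j with hx | hx
  · have := congrFun hfg ⟨x, hx⟩
    simpa [hf.apply_lt hx, hg.apply_lt hx] using this
  · rw [hf.outside x (Or.inr hx), hg.outside x (Or.inr hx)]

/-- All the partitions of `[i, j)`. -/
noncomputable def all (ε : ℕ → Fin 2) (i j : ℕ) : Finset (ℕ → ℕ) :=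
  (finite_setOf ε i j).toFinset

theorem mem_all : f ∈ all ε i j ↔ IsMate ε i j f := by simp [all]

theorem all_self (ε : ℕ → Fin 2) (i : ℕ) : all ε i i = {id} := by
  ext f
  rw [mem_all, Finset.mem_singleton]
  constructor
  · intro hf
    exact funext fun x => hf.outside x (lt_or_ge x i)
  · rintro rfl
    exact ⟨fun _ => rfl, fun _ => rfl, fun _ _ => rfl, fun x y h => by simp at h; omega⟩

/-- The partitions are sorted by the mate of the first point: itself, or some `m` of the same
colour, and then non-crossingness leaves independent partitions inside and to the right of `{i, m}`.
-/
theorem sum_all_of_lt {M : Type*} [AddCommMonoid M] (F : (ℕ → ℕ) → M) (hij : i < j) :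
    ∑ f ∈ all ε i j, F f = ∑ f ∈ all ε (i + 1) j, F f +
      ∑ m ∈ Finset.Ioo i j, if ε m = ε i then
        ∑ g ∈ all ε (i + 1) m, ∑ h ∈ all ε (m + 1) j, F (glue i m g h) else 0 := by
  rw [← Finset.sum_fiberwise_of_maps_to (s := all ε i j) (t := Finset.Ico i j) (g := fun f => f i)
    (fun f hf => by
      have hf := mem_all.1 hf
      exact Finset.mem_Ico.2 ⟨hf.le_apply le_rfl, hf.apply_lt hij⟩),
    ← Finset.sum_Ioo_add_eq_sum_Ico hij, add_comm]
  congr 1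
  · refine Finset.sum_congr ?_ fun _ _ => rfl
    ext f
    rw [Finset.mem_filter, mem_all, mem_all]
    exact ⟨fun h => h.1.of_fixed h.2, fun h => h.mono⟩
  · refine Finset.sum_congr rfl fun m hm => ?_
    obtain ⟨him, hmj⟩ := Finset.mem_Ioo.1 hm
    split_ifs with hε
    · rw [← Finset.sum_product']
      symm
      refine Finset.sum_bij' (fun p _ => glue i m p.1 p.2)
        (fun f _ => (fun x => if i < x ∧ x < m then f x else x, fun x => if m < x then f x else x))
        ?_ ?_ ?_ ?_ fun _ _ => rfl
      · rintro ⟨g, h⟩ hp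
        rw [Finset.mem_product, mem_all, mem_all] at hp
        rw [Finset.mem_filter, mem_all]
        exact ⟨glue_isMate him hmj hε hp.1 hp.2, by simp [glue]⟩
      · intro f hf
        rw [Finset.mem_filter, mem_all] at hf
        obtain ⟨hf, rfl⟩ := hf
        rw [Finset.mem_product, mem_all, mem_all]
        exact ⟨hf.inside_isMate him, hf.right_isMate him⟩
      · rintro ⟨g, h⟩ hp
        rw [Finset.mem_product, mem_all, mem_all] at hp
        simp only [Prod.mk.injEq]
        constructor
        · funext x
          have := hp.1.outside x
          simp only [glue]
          grind
        · funext x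
          have := hp.2.outside x
          simp only [glue]
          grind
      · intro f hf
        rw [Finset.mem_filter, mem_all] at hf
        obtain ⟨hf, rfl⟩ := hf
        exact hf.glue_split
    · refine Finset.sum_eq_zero fun f hf => ?_
      rw [Finset.mem_filter, mem_all] at hf
      exact absurd (hf.2 ▸ hf.1.color i) hε
end IsMate

/-! ### The value of one partition, with depths tracked from the outside in. -/

section NestedValue

variable {B : Type v} [CStarAlgebra B] [PartialOrder B] [StarOrderedRing B]
variable (J : Fin 2 → JacobiParams B) (ε : ℕ → Fin 2) (b : ℕ → B)

/-- The value of the segment `[i, j)` according to the partition with mate function `f`, where the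
outer blocks have depths `D` and the last coefficient is `β`. -/
noncomputable def nestedValue (D : Fin 2 → ℕ) (f : ℕ → ℕ) (i j : ℕ) (β : B) : B :=
  if i < j then
    if f i = i then b i * (J (ε i)).lam (D (ε i)) * nestedValue D f (i + 1) j β
    else if i < f i ∧ f i < j then
      b i * (J (ε i)).alpha (D (ε i))
        (nestedValue (innerDepth D (ε i)) f (i + 1) (f i) (b (f i))) *
        nestedValue D f (f i + 1) j β
    else 0
  else β
termination_by j - i

theorem nestedValue_congr (D : Fin 2 → ℕ) {f g : ℕ → ℕ} {i j : ℕ} (β : B)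
    (h : ∀ x, i ≤ x → x < j → f x = g x) :
    nestedValue J ε b D f i j β = nestedValue J ε b D g i j β := by
  obtain ⟨n, hn⟩ : ∃ n, n = j - i := ⟨_, rfl⟩
  induction n using Nat.strong_induction_on generalizing i j D β with
  | _ n ih =>
  rw [nestedValue, nestedValue.eq_def J ε b D g]
  by_cases hij : i < j
  · rw [if_pos hij, if_pos hij, ← h i le_rfl hij]
    split_ifs with h1 h2
    · rw [ih (j - (i + 1)) (by omega) D β (fun x _ _ => h x (by omega) (by omega)) rfl]
    · rw [ih (j - (f i + 1)) (by omega) D β (fun x _ _ => h x (by omega) (by omega)) rfl,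
        ih (f i - (i + 1)) (by omega) _ _ (fun x _ _ => h x (by omega) (by omega)) rfl]
    · rfl
  · rw [if_neg hij, if_neg hij]

/-- Since `alpha` is additive, the sum over the inner partitions can be moved inside it; the sums
over the inner and the right-hand partitions then factor. -/
theorem sum_nestedValue (D : Fin 2 → ℕ) {i j : ℕ} (hij : i ≤ j) (β : B) :
    ∑ f ∈ IsMate.all ε i j, nestedValue J ε b D f i j β = nestedSum J ε b D i j β := by
  obtain ⟨n, hn⟩ : ∃ n, n = j - i := ⟨_, rfl⟩
  induction n using Nat.strong_induction_on generalizing i j D β with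
  | _ n ih =>
  rcases hij.eq_or_lt with rfl | hij
  · rw [nestedSum_self, IsMate.all_self, Finset.sum_singleton, nestedValue, if_neg (lt_irrefl _)]
  rw [IsMate.sum_all_of_lt _ hij, nestedSum_of_lt _ _ _ _ hij]
  congr 1
  · rw [← ih (j - (i + 1)) (by omega) D (by omega) β rfl, Finset.mul_sum]
    refine Finset.sum_congr rfl fun f hf => ?_
    rw [nestedValue, if_pos hij, if_pos (IsMate.mem_all.1 hf).mono.2]
  · refine Finset.sum_congr rfl fun m hm => ?_
    obtain ⟨him, hmj⟩ := Finset.mem_Ioo.1 hm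
    split_ifs with hε
    · rw [← ih (j - (m + 1)) (by omega) D (by omega) β rfl,
        ← ih (m - (i + 1)) (by omega) _ (by omega) _ rfl, map_sum, Finset.mul_sum,
        Finset.sum_comm]
      refine Finset.sum_congr rfl fun h hh => ?_
      rw [Finset.mul_sum, Finset.sum_mul]
      refine Finset.sum_congr rfl fun g hg => ?_
      have e : IsMate.glue i m g h i = m := by simp [IsMate.glue]
      rw [nestedValue, if_pos hij, e, if_neg (by omega), if_pos ⟨him, hmj⟩]
      -- A value reads the mate function only on its own interval, where the glued one is `g` or
      -- `h`.
      rw [nestedValue_congr J ε b (innerDepth D (ε i)) (g := g) (b m)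
          fun x _ _ => by simp only [IsMate.glue]; grind,
        nestedValue_congr J ε b D (i := m + 1) (g := h) β
          fun x _ _ => by simp only [IsMate.glue]; grind]
    · rfl

end NestedValue

/-! ### Relative depth along the nesting of blocks, and the sum of moments. -/

namespace TCNC

variable {d : ℕ} (π : TCNC d)

theorem mate_injective : Function.Injective π.mate :=
  Function.LeftInverse.injective π.mate_mate

/-- The end of a covering pair lies beyond the ends of what it covers. -/
theorem Covers.mate_lt {π : TCNC d} {a x : Fin d} (h : π.Covers a x) : π.mate x < π.mate a := by
  have h1 := π.noncrossing a x
  have h2 : π.mate x ≠ π.mate a := fun e => h.1.ne' (π.mate_injective e)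
  have := h.1
  have := h.2
  omega

theorem Covers.lt_mate {π : TCNC d} {a x : Fin d} (h : π.Covers a x) : a < π.mate x := by
  have h1 := π.noncrossing (π.mate x) a
  rw [π.mate_mate] at h1
  have h3 : π.mate x ≠ a := fun e => by
    have := h.2
    rw [← e, π.mate_mate] at this
    exact lt_irrefl _ this
  have := h.1
  have := h.2
  omega

theorem Covers.trans {π : TCNC d} {a x y : Fin d} (h : π.Covers a x) (h' : π.Covers x y) :
    π.Covers a y :=
  ⟨h.1.trans h'.1, h'.2.trans h.mate_lt⟩

/-- Of two pairs covering the same point, the one that begins first covers the other one. -/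
theorem Covers.covers_of_lt {π : TCNC d} {a r x : Fin d} (ha : π.Covers a x) (hr : π.Covers r x)
    (h : r < a) : π.Covers r a :=
  ⟨h, ha.1.trans hr.2⟩

theorem depth_of_not_covered {x : Fin d} (h : ∀ a, ¬ π.Covers a x) : π.depth x = 1 := by
  simp [depth, h]

/-- The relative depth of a block, in terms of that of the pair that covers it directly. -/
theorem depth_of_covers {a x : Fin d} (hax : π.Covers a x)
    (h : ∀ r, π.Covers r x → r ≤ a) :
    π.depth x = if π.color a = π.color x then π.depth a + 1 else 1 := by
  split_ifs with hc
  · have e : {r : Fin d | π.IsPair (π.color x) r ∧ π.Covers r x ∧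
        ∀ q c, c ≠ π.color x → π.IsPair c q → π.Covers q x → q < r} =
        insert a {r : Fin d | π.IsPair (π.color a) r ∧ π.Covers r a ∧
        ∀ q c, c ≠ π.color a → π.IsPair c q → π.Covers q a → q < r} := by
      ext r
      simp only [Set.mem_ofPred_eq, Set.mem_insert_iff, hc]
      constructor
      · rintro ⟨h1, h2, h3⟩
        rcases (h r h2).eq_or_lt with rfl | hlt
        · exact Or.inl rfl
        · exact Or.inr ⟨h1, hax.covers_of_lt h2 hlt,
            fun q c hq hq' hqa => h3 q c hq hq' (hqa.trans hax)⟩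
      · rintro (rfl | ⟨h1, h2, h3⟩)
        · refine ⟨⟨hc, hax.1.trans hax.2⟩, hax, fun q c hq hq' hqx => ?_⟩
          refine lt_of_le_of_ne (h q hqx) ?_
          rintro rfl
          exact hq (hq'.1.symm.trans hc)
        · refine ⟨h1, h2.trans hax, fun q c hq hq' hqx => ?_⟩
          rcases (h q hqx).eq_or_lt with rfl | hlt
          · exact absurd (hq'.1.symm.trans hc) hq
          · exact h3 q c hq hq' (hax.covers_of_lt hqx hlt)
    rw [depth, e, Set.ncard_insert_of_notMem (fun h => lt_irrefl _ h.2.1.1), depth]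
    omega
  -- Opposite colour: `a` is innermost, so no pair of the colour of `x` lies inside it and covers
  -- `x`.
  · have e : {r : Fin d | π.IsPair (π.color x) r ∧ π.Covers r x ∧
        ∀ q c, c ≠ π.color x → π.IsPair c q → π.Covers q x → q < r} = ∅ := by
      ext r
      simp only [Set.mem_ofPred_eq, Set.mem_empty_iff_false, iff_false]
      rintro ⟨_, h2, h3⟩
      exact absurd (h3 a _ hc ⟨rfl, hax.1.trans hax.2⟩ hax) (not_lt.2 (h r h2))
    rw [depth, e, Set.ncard_empty]

/-- The mate function, extended to all natural numbers. -/
def natMate (x : ℕ) : ℕ :=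
  if h : x < d then π.mate ⟨x, h⟩ else x

theorem natMate_val (x : Fin d) : π.natMate x = π.mate x := by
  simp [natMate]

/-- `[i, j)` is a union of blocks, and the outer blocks of it have depths `D`. -/
structure IsLevel (D : Fin 2 → ℕ) (i j : ℕ) : Prop where
  le : j ≤ d
  closed : ∀ x : Fin d, i ≤ (x : ℕ) → (x : ℕ) < j → i ≤ (π.mate x : ℕ) ∧ (π.mate x : ℕ) < j
  depth_eq : ∀ x : Fin d, i ≤ (x : ℕ) → (x : ℕ) < j →
    (∀ a : Fin d, i ≤ (a : ℕ) → ¬ π.Covers a x) → π.depth x = D (π.color x)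

variable {π}

namespace IsLevel

variable {D : Fin 2 → ℕ} {i j : ℕ}

theorem depth_left (h : π.IsLevel D i j) (hij : i < j) (hi : i < d) :
    π.depth ⟨i, hi⟩ = D (π.color ⟨i, hi⟩) :=
  h.depth_eq ⟨i, hi⟩ le_rfl hij fun _ ha hc => absurd hc.1 (not_lt.2 ha)

theorem right (h : π.IsLevel D i j) (hi : i < d) (him : i ≤ (π.mate ⟨i, hi⟩ : ℕ)) :
    π.IsLevel D (π.mate ⟨i, hi⟩ + 1) j := by
  refine ⟨h.le, fun x hx hxj => ?_, fun x hx hxj hc => ?_⟩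
  · refine ⟨?_, (h.closed x (by omega) hxj).2⟩
    have h0 := (h.closed x (by omega) hxj).1
    have h1 := π.noncrossing ⟨i, hi⟩ (π.mate x)
    rw [π.mate_mate] at h1
    have h2 : π.mate x ≠ π.mate ⟨i, hi⟩ := fun e => by
      have := π.mate_injective e
      subst this
      simp at hx
      omega
    have h3 : π.mate x ≠ ⟨i, hi⟩ := fun e => by
      rw [← e, π.mate_mate] at hx
      omega
    have h3' : (π.mate x : ℕ) ≠ i := fun e => h3 (Fin.ext e)
    have h2' : (π.mate x : ℕ) ≠ π.mate ⟨i, hi⟩ := fun e => h2 (Fin.ext e)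
    simp only [Fin.lt_def] at h1
    omega
  · refine h.depth_eq x (by omega) hxj fun a ha hax => ?_
    rcases Nat.lt_or_ge (π.mate ⟨i, hi⟩) a with h1 | h1
    · exact hc a h1 hax
    -- A pair beginning no later than the mate of `i` cannot reach beyond that mate, so it does not
    -- cover `x`.
    · have h3 := π.noncrossing ⟨i, hi⟩ a
      have h4 := hax.2
      simp only [Fin.lt_def] at h3 h4
      have h5 : (a : ℕ) ≠ i := fun e => by
        have : a = ⟨i, hi⟩ := Fin.ext e
        subst this
        omega
      have h6 : (a : ℕ) ≠ π.mate ⟨i, hi⟩ := fun e => by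
        have : a = π.mate ⟨i, hi⟩ := Fin.ext e
        rw [this, π.mate_mate] at h4
        simp at h4
        omega
      omega

theorem inside (h : π.IsLevel D i j) (hij : i < j) (hi : i < d) :
    π.IsLevel (innerDepth D (π.color ⟨i, hi⟩)) (i + 1) (π.mate ⟨i, hi⟩) := by
  refine ⟨(π.mate ⟨i, hi⟩).2.le, fun x hx hxm => ?_, fun x hx hxm hc => ?_⟩
  · have hcov : π.Covers ⟨i, hi⟩ x := ⟨hx, hxm⟩
    exact ⟨hcov.lt_mate, hcov.mate_lt⟩
  · have hcov : π.Covers ⟨i, hi⟩ x := ⟨hx, hxm⟩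
    rw [π.depth_of_covers hcov, h.depth_left hij hi]
    · rfl
    · intro r hr
      by_contra hlt
      exact hc r (by simpa [Fin.lt_def] using hlt) hr

end IsLevel

theorem isLevel_zero (π : TCNC d) : π.IsLevel (fun _ => 1) 0 d :=
  ⟨le_rfl, fun x _ _ => ⟨Nat.zero_le _, (π.mate x).2⟩,
    fun _ _ _ h => π.depth_of_not_covered fun a => h a (Nat.zero_le _)⟩

section Moment

variable {B : Type v} [CStarAlgebra B] [PartialOrder B] [StarOrderedRing B]
variable (J : Fin 2 → JacobiParams B) (b : ℕ → B)

theorem segment_of_fixed {i j : ℕ} (hij : i < j) (hi : i < d)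
    (h : (π.mate ⟨i, hi⟩ : ℕ) = i) :
    π.segment J b i j = b i * (J (π.color ⟨i, hi⟩)).lam (π.depth ⟨i, hi⟩) *
      π.segment J b (i + 1) j := by
  rw [segment, dif_pos ⟨hij, hi⟩]
  simp only [if_pos h]

theorem segment_of_pair {i j : ℕ} (hi : i < d)
    (h : i < (π.mate ⟨i, hi⟩ : ℕ)) (h' : (π.mate ⟨i, hi⟩ : ℕ) < j) :
    π.segment J b i j = b i * (J (π.color ⟨i, hi⟩)).alpha (π.depth ⟨i, hi⟩)
      (π.segment J b (i + 1) (π.mate ⟨i, hi⟩)) *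
      π.segment J b (π.mate ⟨i, hi⟩ + 1) j := by
  rw [segment, dif_pos ⟨h.trans h', hi⟩]
  simp only [if_neg h.ne', if_pos (And.intro h h')]

theorem segment_self (i : ℕ) : π.segment J b i i = b i := by
  rw [segment, dif_neg (by simp)]

/-- Induction on the segments of a partition. -/
theorem IsLevel.induction {P : (Fin 2 → ℕ) → ℕ → ℕ → Prop} (nil : ∀ D i, P D i i)
    (single : ∀ D i j (hi : i < d), i < j → π.IsLevel D i j → (π.mate ⟨i, hi⟩ : ℕ) = i →
      P D (i + 1) j → P D i j)
    (pair : ∀ D i j (hi : i < d), π.IsLevel D i j → i < (π.mate ⟨i, hi⟩ : ℕ) →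
      (π.mate ⟨i, hi⟩ : ℕ) < j →
      P (innerDepth D (π.color ⟨i, hi⟩)) (i + 1) (π.mate ⟨i, hi⟩) →
      P D (π.mate ⟨i, hi⟩ + 1) j → P D i j)
    {D : Fin 2 → ℕ} {i j : ℕ} (hij : i ≤ j) (h : π.IsLevel D i j) : P D i j := by
  obtain ⟨n, hn⟩ : ∃ n, n = j - i := ⟨_, rfl⟩
  induction n using Nat.strong_induction_on generalizing i j D with
  | _ n ih =>
  rcases hij.eq_or_lt with rfl | hij
  · exact nil D i
  have hi : i < d := hij.trans_le h.le
  obtain ⟨h1, h2⟩ := h.closed ⟨i, hi⟩ le_rfl hij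
  have hr := h.right hi h1
  rcases Nat.eq_or_lt_of_le h1 with h1 | h1
  · rw [← h1] at hr
    exact single D i j hi hij h h1.symm (ih (j - (i + 1)) (by omega) (by omega) hr rfl)
  · exact pair D i j hi h h1 h2
      (ih _ (by omega) (by omega) (h.inside hij hi) rfl) (ih _ (by omega) (by omega) hr rfl)

/-- `segment` reads depths off the whole partition, `nestedValue` carries them along; `IsLevel` is
the invariant that makes them agree. -/
theorem segment_eq_nestedValue {ε : ℕ → Fin 2} (hε : ∀ x : Fin d, π.color x = ε x)
    {D : Fin 2 → ℕ} {i j : ℕ} (hij : i ≤ j) (h : π.IsLevel D i j) :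
    π.segment J b i j = nestedValue J ε b D π.natMate i j (b j) := by
  refine IsLevel.induction (P := fun D i j => π.segment J b i j =
    nestedValue J ε b D π.natMate i j (b j)) ?_ ?_ ?_ hij h
  · intro D i
    rw [segment_self, nestedValue, if_neg (lt_irrefl i)]
  · intro D i j hi hij h hm ih
    have e : π.natMate i = i := (π.natMate_val ⟨i, hi⟩).trans hm
    rw [segment_of_fixed J b hij hi hm, nestedValue, if_pos hij, if_pos e, ih,
      h.depth_left hij hi, hε]
  · intro D i j hi h h1 h2 ih1 ih2
    have e : π.natMate i = _ := π.natMate_val ⟨i, hi⟩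
    rw [segment_of_pair J b hi h1 h2, nestedValue, if_pos (h1.trans h2), e, if_neg h1.ne',
      if_pos ⟨h1, h2⟩, ih1, ih2, h.depth_left (h1.trans h2) hi, hε]

/-- The sum of the moments over all partitions with given colours. -/
theorem sum_moment (ε : ℕ → Fin 2) :
    ∑ π : TCNC d with π.color = (fun x : Fin d => ε x), π.moment J b =
      nestedSum J ε b (fun _ => 1) 0 d (b d) := by
  rw [← sum_nestedValue J ε b _ (Nat.zero_le d)]
  refine Finset.sum_bij (fun π _ => π.natMate) ?_ ?_ ?_ ?_
  · intro π hπ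
    rw [Finset.mem_filter] at hπ
    rw [IsMate.mem_all]
    have hc : ∀ x : Fin d, π.color x = ε x := fun x => congrFun hπ.2 x
    refine ⟨fun x => ?_, fun x => ?_, fun x hx => ?_, fun x y => ?_⟩
    · by_cases h : x < d
      · simp [natMate, h, π.mate_mate]
      · simp [natMate, h]
    · by_cases h : x < d
      · simp [natMate, h, ← hc, π.color_mate]
        rw [← hc ⟨x, h⟩]
      · simp [natMate, h]
    · simp [natMate, show ¬ x < d by omega]
    · rintro ⟨h1, h2, h3⟩
      simp only [natMate] at h2 h3
      split_ifs at h2 h3 with h4 h5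
      · exact π.noncrossing ⟨x, h4⟩ ⟨y, h5⟩ ⟨h1, h2, h3⟩
      · have := (π.mate ⟨x, h4⟩).2
        omega
      · omega
      · omega
  · intro π hπ σ hσ h
    rw [Finset.mem_filter] at hπ hσ
    refine TCNC.ext (funext fun x => Fin.ext ?_) (hπ.2.trans hσ.2.symm)
    rw [← natMate_val, ← natMate_val]
    exact congrFun h x
  · intro f hf
    rw [IsMate.mem_all] at hf
    refine ⟨⟨fun x => ⟨f x, hf.apply_lt x.2⟩, fun x => ε x, fun x => Fin.ext (hf.invol x),
      fun x => hf.color x, fun x y => hf.noncrossing x y⟩, by simp, ?_⟩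
    funext x
    by_cases h : x < d
    · simp [natMate, h]
    · simp [natMate, h, hf.outside x (Or.inr (not_lt.1 h))]
  · intro π hπ
    rw [Finset.mem_filter] at hπ
    exact segment_eq_nestedValue J b (fun x => congrFun hπ.2 x) (Nat.zero_le d) π.isLevel_zero

end Moment

end TCNC

/-! ### Vanishing of moments, and depth versus chains of nested pairs. -/

namespace TCNC

variable {d : ℕ} {π : TCNC d}

section Vanishing

variable {B : Type v} [CStarAlgebra B] [PartialOrder B] [StarOrderedRing B]
variable (J : Fin 2 → JacobiParams B) (b : ℕ → B)

/-- The value is built by products and applications of linear maps, so one vanishing block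
annihilates every segment that contains it. -/
theorem segment_eq_zero {x : Fin d}
    (hx : (π.mate x = x ∧ (J (π.color x)).lam (π.depth x) = 0) ∨
      (x < π.mate x ∧ ∀ y, (J (π.color x)).alpha (π.depth x) y = 0))
    {D : Fin 2 → ℕ} {i j : ℕ} (hij : i ≤ j) (h : π.IsLevel D i j) (hix : i ≤ x) (hxj : x < j) :
    π.segment J b i j = 0 := by
  refine IsLevel.induction (P := fun D i j => i ≤ x → x < j → π.segment J b i j = 0)
    ?_ ?_ ?_ hij h hix hxj
  · intro D i h1 h2
    omega
  · intro D i j hi hij h hm ih hix hxj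
    rw [segment_of_fixed J b hij hi hm]
    rcases hix.eq_or_lt with rfl | hlt
    · rcases hx with hx | hx
      · rw [hx.2, mul_zero, zero_mul]
      · exact absurd hm (ne_of_gt hx.1)
    · rw [ih hlt hxj, mul_zero]
  · intro D i j hi h h1 h2 ih1 ih2 hix hxj
    rw [segment_of_pair J b hi h1 h2]
    rcases hix.eq_or_lt with rfl | hlt
    · rcases hx with hx | hx
      · exact absurd (congrArg Fin.val hx.1) (ne_of_gt h1)
      · rw [hx.2, mul_zero, zero_mul]
    rcases lt_trichotomy (x : ℕ) (π.mate ⟨i, hi⟩) with h3 | h3 | h3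
    · rw [ih1 hlt h3, map_zero, mul_zero, zero_mul]
    -- Impossible: `x` would be a right end, while `hx` makes it a singleton or a left end.
    · have hxm : x = π.mate ⟨i, hi⟩ := Fin.ext h3
      rw [hxm, π.mate_mate] at hx
      rcases hx with hx | hx
      · exact absurd (congrArg Fin.val hx.1) (ne_of_lt h1)
      · exact absurd (lt_trans hx.1 h1) (lt_irrefl _)
    · rw [ih2 h3 hxj, mul_zero]

theorem moment_eq_zero {x : Fin d}
    (hx : (π.mate x = x ∧ (J (π.color x)).lam (π.depth x) = 0) ∨
      (x < π.mate x ∧ ∀ y, (J (π.color x)).alpha (π.depth x) y = 0)) :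
    π.moment J b = 0 :=
  segment_eq_zero J b hx (Nat.zero_le d) π.isLevel_zero (Nat.zero_le _) x.2

theorem segment_eq_one (hb : ∀ i, b i = 1)
    (hπ : ∀ x, x < π.mate x → (J (π.color x)).alpha (π.depth x) 1 = 1)
    (hm : ∀ x, π.mate x ≠ x)
    {D : Fin 2 → ℕ} {i j : ℕ} (hij : i ≤ j) (h : π.IsLevel D i j) :
    π.segment J b i j = 1 := by
  refine IsLevel.induction (P := fun D i j => π.segment J b i j = 1) ?_ ?_ ?_ hij h
  · intro D i
    rw [segment_self, hb]
  · intro D i j hi hij h hfix ih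
    exact absurd (Fin.ext hfix) (hm _)
  · intro D i j hi h h1 h2 ih1 ih2
    rw [segment_of_pair J b hi h1 h2, hb, ih1, ih2, hπ _ h1, mul_one, mul_one]

end Vanishing

/-- In a chain of `k` nested pairs not separated by the other colour, the innermost pair works: the
other `k - 1` all count towards its depth. -/
theorem exists_le_depth_of_not_depthLT {c : Fin 2} {k : ℕ} (h : ¬ π.DepthLT c k) :
    ∃ x, π.IsPair c x ∧ k ≤ π.depth x := by
  classical
  simp only [DepthLT, not_forall] at h
  obtain ⟨hk, f, hf, hf', hp, hn⟩ := h
  set z : Fin k := ⟨k - 1, Nat.sub_lt hk one_pos⟩ with hz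
  have hle : ∀ i : Fin k, i ≤ z := fun i => Nat.le_sub_one_of_lt i.2
  have hcov : ∀ i : Fin k, i < z → π.Covers (f i) (f z) := fun i hi =>
    ⟨hf hi, (hp z).2.trans (hf' hi)⟩
  refine ⟨f z, hp z, ?_⟩
  have hsub : (Finset.univ.filter (· < z)).image f ⊆
      ({a : Fin d | π.IsPair (π.color (f z)) a ∧ π.Covers a (f z) ∧
        ∀ r c, c ≠ π.color (f z) → π.IsPair c r → π.Covers r (f z) → r < a}).toFinite.toFinset := by
    intro a ha
    simp only [Finset.mem_image, Finset.mem_filter, Finset.mem_univ, true_and] at ha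
    obtain ⟨i, hi, rfl⟩ := ha
    simp only [Set.Finite.mem_toFinset, Set.mem_ofPred_eq, (hp z).1]
    refine ⟨hp i, hcov i hi, fun r c' hc' hr hrz => ?_⟩
    have h0 : (⟨0, hk⟩ : Fin k) ≤ i := Nat.zero_le _
    -- Otherwise `r` begins after the outermost pair of the chain and covers the innermost one, so
    -- it separates them, contrary to `hn`.
    by_contra hlt
    have h0r : f ⟨0, hk⟩ < r := by
      refine lt_of_le_of_ne ((hf.monotone h0).trans (not_lt.1 hlt)) fun e => ?_
      rw [← e] at hr
      exact hc' (hr.1.symm.trans (hp _).1)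
    exact hn ⟨r, c', hc', hr, h0r, hrz.1, hrz.mate_lt,
      Covers.mate_lt ⟨h0r, hrz.1.trans (hcov _ (lt_of_le_of_lt h0 hi)).2⟩⟩
  have hcard := Finset.card_le_card hsub
  rw [Finset.card_image_of_injective _ hf.injective] at hcard
  have : (Finset.univ.filter (· < z)).card = k - 1 := by
    rw [hz, Finset.filter_gt_eq_Iio, Fin.card_Iio]
  rw [depth, Set.ncard_eq_toFinset_card]
  omega

/-- If the depth were at least `k`, `x` and the pairs counted in its depth would contain a nested
chain of length `k`. A separating pair would cover `x` and begin after the outermost member of the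
chain, which is then not counted. -/
theorem depth_lt_of_depthLT {c : Fin 2} {k : ℕ} (hk : 0 < k) (h : π.DepthLT c k) {x : Fin d}
    (hx : π.IsPair c x) : π.depth x < k := by
  classical
  by_contra hle
  obtain ⟨hxc, hxm⟩ := hx
  set S := {a : Fin d | π.IsPair (π.color x) a ∧ π.Covers a x ∧
        ∀ r c, c ≠ π.color x → π.IsPair c r → π.Covers r x → r < a} with hS
  have hxS : x ∉ S := fun h => lt_irrefl _ h.2.1.1
  have hcard : k ≤ (insert x S).toFinite.toFinset.card := by
    rw [← Set.ncard_eq_toFinset_card, Set.ncard_insert_of_notMem hxS]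
    rw [depth, ← hS] at hle
    omega
  obtain ⟨T, hT, hTk⟩ := Finset.exists_subset_card_eq hcard
  let f := T.orderEmbOfFin hTk
  have hfS : ∀ i, f i = x ∨ f i ∈ S := fun i => by
    have := hT (T.orderEmbOfFin_mem hTk i)
    rwa [Set.Finite.mem_toFinset, Set.mem_insert_iff] at this
  have hfx : ∀ i, f i ≤ x := fun i => (hfS i).elim (fun h => h.le) fun h => h.2.1.1.le
  have hmate : ∀ i, π.mate x ≤ π.mate (f i) := fun i =>
    (hfS i).elim (fun h => by rw [h]) fun h => h.2.1.mate_lt.le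
  obtain ⟨r, c', hc', hr, h1, h2, h3, h4⟩ := h hk f f.strictMono (fun i j hij => by
      have hlt : f i < f j := f.strictMono hij
      refine Covers.mate_lt ⟨hlt, lt_of_le_of_lt (hfx j) (hxm.trans_le (hmate i))⟩) (fun i => by
      rcases hfS i with h | h
      · rw [h]; exact ⟨hxc, hxm⟩
      · rw [← hxc]; exact h.1)
  have hrx : π.Covers r x := ⟨h2.trans_le (hfx _), hxm.trans_le ((hmate _).trans h3.le)⟩
  rcases hfS ⟨0, hk⟩ with h0 | h0
  · have := hfx ⟨k - 1, Nat.sub_lt hk one_pos⟩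
    rw [← h0] at this
    exact absurd (h1.trans h2) (not_lt.2 this)
  · exact absurd (h0.2.2 r c' (hxc ▸ hc') hr hrx) (not_lt.2 h1.le)

variable {B : Type v} [CStarAlgebra B] [PartialOrder B] [StarOrderedRing B]

theorem mem_relDepth {k l : ℕ} : π ∈ relDepth k l d ↔ π.DepthLT 0 k ∧ π.DepthLT 1 l := by
  simp [relDepth]

theorem moment_eq_zero_of_notMem_relDepth {J : Fin 2 → JacobiParams B} {k l : ℕ}
    (hk : (J 0).HasDepth k) (hl : (J 1).HasDepth l) (b : ℕ → B)
    (hπ : π ∉ relDepth k l d) : π.moment J b = 0 := by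
  rw [mem_relDepth, not_and_or] at hπ
  rcases hπ with h | h
  · obtain ⟨x, hx, hkx⟩ := exists_le_depth_of_not_depthLT h
    exact moment_eq_zero J b (Or.inr ⟨hx.2, by rw [hx.1]; exact hk.2 _ hkx⟩)
  · obtain ⟨x, hx, hlx⟩ := exists_le_depth_of_not_depthLT h
    exact moment_eq_zero J b (Or.inr ⟨hx.2, by rw [hx.1]; exact hl.2 _ hlx⟩)

end TCNC

/-! ## Wick products -/

section Words

variable {B : Type v}

/-- One plus the number of letters of colour `c` at the beginning of a word. -/
def runDepth (c : Fin 2) : List (Fin 2 × B) → ℕ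
  | [] => 1
  | x :: t => if x.1 = c then runDepth c t + 1 else 1

/-- The bridge between the two pictures: creating a letter changes the run depths exactly as
entering a pair changes the depths of blocks. -/
theorem runDepth_cons (c : Fin 2) (β : B) (t : List (Fin 2 × B)) :
    (fun c' => runDepth c' ((c, β) :: t)) = innerDepth (fun c' => runDepth c' t) c := by
  funext c'
  simp only [runDepth, innerDepth]
  split_ifs with h
  · rw [h]
  · rfl

/-- A word with letters of one colour only. -/
def monoWord (c : Fin 2) (r : List B) : List (Fin 2 × B) := r.map fun β => (c, β)

theorem runDepth_monoWord_append (c : Fin 2) (r : List B) {s : List (Fin 2 × B)}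
    (hs : ∀ x ∈ s.head?, x.1 ≠ c) : runDepth c (monoWord c r ++ s) = r.length + 1 := by
  induction r with
  | nil =>
    cases s with
    | nil => rfl
    | cons x s =>
      have : x.1 ≠ c := hs x (by simp)
      simp [monoWord, runDepth, this]
  | cons β r ih =>
    simp only [monoWord, List.map_cons, List.cons_append, runDepth, if_true, List.length_cons] at *
    rw [ih]

theorem runDepth_monoWord (c : Fin 2) (r : List B) :
    runDepth c (monoWord c r) = r.length + 1 := by
  simpa using runDepth_monoWord_append c r (s := []) (by simp)

end Words

section Wick

variable {A : Type u} {B : Type v} [CStarAlgebra A] [CStarAlgebra B] [PartialOrder B]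
  [StarOrderedRing B]

variable (ι : B →⋆ₐ[ℂ] A) (X : Fin 2 → A) (J : Fin 2 → JacobiParams B)

/-- The Wick product of the word `β X_{c₁} β₁ X_{c₂} ⋯ X_{cₙ} βₙ`: the polynomial in `X` which
creates this word from the vacuum. -/
noncomputable def wick : List (Fin 2 × B) → B → A
  | [], β => ι β
  | (c, β₁) :: t, β => ι β * (X c * wick t β₁ - wick t ((J c).lam (runDepth c t) * β₁) -
      match t with
      | [] => 0
      | (c', β₂) :: t' =>
        if c' = c then wick t' ((J c).alpha (runDepth c t') β₁ * β₂) else 0)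

theorem wick_nil (β : B) : wick ι X J [] β = ι β := rfl

theorem wick_cons_nil (c : Fin 2) (β₁ β : B) : wick ι X J [(c, β₁)] β =
    ι β * (X c * ι β₁ - ι ((J c).lam 1 * β₁)) := by
  simp [wick, runDepth]

theorem wick_cons_cons (c c' : Fin 2) (β₁ β₂ β : B) (t : List (Fin 2 × B)) :
    wick ι X J ((c, β₁) :: (c', β₂) :: t) β =
    ι β * (X c * wick ι X J ((c', β₂) :: t) β₁ -
      wick ι X J ((c', β₂) :: t) ((J c).lam (runDepth c ((c', β₂) :: t)) * β₁) -
      if c' = c then wick ι X J t ((J c).alpha (runDepth c t) β₁ * β₂) else 0) := by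
  rw [wick]

theorem wick_eq_mul (t : List (Fin 2 × B)) (β : B) :
    wick ι X J t β = ι β * wick ι X J t 1 := by
  cases t with
  | nil => simp [wick]
  | cons x t =>
    obtain ⟨c, β₁⟩ := x
    cases t with
    | nil => rw [wick_cons_nil, wick_cons_nil, map_one, one_mul]
    | cons y t => rw [wick_cons_cons, wick_cons_cons, map_one, one_mul]

theorem incl_mul_wick (t : List (Fin 2 × B)) (β β' : B) :
    ι β * wick ι X J t β' = wick ι X J t (β * β') := by
  rw [wick_eq_mul, wick_eq_mul _ _ _ _ (β * β'), map_mul, mul_assoc]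

/-- Multiplication by a variable is the sum of creation, preservation and annihilation. -/
theorem X_mul_wick_nil (c : Fin 2) (β : B) : X c * wick ι X J [] β =
    wick ι X J [(c, β)] 1 + wick ι X J [] ((J c).lam 1 * β) := by
  simp [wick, runDepth]

theorem X_mul_wick_cons (c c' : Fin 2) (β β₁ : B) (t : List (Fin 2 × B)) :
    X c * wick ι X J ((c', β₁) :: t) β =
    wick ι X J ((c, β) :: (c', β₁) :: t) 1 +
      wick ι X J ((c', β₁) :: t) ((J c).lam (runDepth c ((c', β₁) :: t)) * β) +
      if c' = c then wick ι X J t ((J c).alpha (runDepth c t) β * β₁) else 0 := by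
  rw [wick_cons_cons, map_one, one_mul]
  abel

/-- At a change of colour nothing is annihilated and the run depth restarts, so the recursion for
the run `r` never sees `s`. The induction goes back two steps because annihilation shortens the word
below its tail. -/
theorem wick_monoWord_append (c : Fin 2) (r : List B) {s : List (Fin 2 × B)}
    (hs : ∀ x ∈ s.head?, x.1 ≠ c) (β : B) :
    wick ι X J (monoWord c r ++ s) β = wick ι X J (monoWord c r) β * wick ι X J s 1 := by
  obtain ⟨n, hn⟩ : ∃ n, n = r.length := ⟨_, rfl⟩
  induction n using Nat.strong_induction_on generalizing r β with
  | _ n ih =>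
  match r with
  | [] => exact wick_eq_mul ι X J s β
  | [β₁] =>
    have h1 : wick ι X J s β₁ = ι β₁ * wick ι X J s 1 := wick_eq_mul ι X J s β₁
    have h2 := runDepth_monoWord_append c [] hs
    simp only [monoWord, List.map_nil, List.nil_append, List.length_nil, zero_add] at h2
    cases s with
    | nil => simp [monoWord, wick]
    | cons x s =>
      have hx : x.1 ≠ c := hs x (by simp)
      obtain ⟨c', β'⟩ := x
      simp only [monoWord, List.map_cons, List.map_nil, List.cons_append, List.nil_append,
        wick_cons_cons _ _ _ c, wick_cons_nil, h2]
      rw [if_neg hx, h1, wick_eq_mul _ _ _ _ ((J c).lam 1 * β₁)]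
      noncomm_ring
  | β₁ :: β₂ :: r =>
    have e1 := ih (r.length + 1) (by rw [hn]; simp) (β₂ :: r)
    have e2 := ih r.length (by rw [hn]; simp) r
    have h1 := runDepth_monoWord_append c (β₂ :: r) hs
    have h2 := runDepth_monoWord_append c r hs
    have h3 := runDepth_monoWord c (β₂ :: r)
    have h4 := runDepth_monoWord c r
    simp only [monoWord, List.map_cons, List.cons_append, wick_cons_cons,
      if_true] at e1 e2 h1 h2 h3 h4 ⊢
    rw [e1 _ rfl, e1 _ rfl, h1, h2, h3, h4, e2 _ trivial]
    noncomm_ring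

theorem wick_monoWord_mem_adjoin (c : Fin 2) (r : List B) (β : B) :
    wick ι X J (monoWord c r) β ∈ Algebra.adjoin ℂ (Set.range ι ∪ {X c}) := by
  have hι : ∀ b, ι b ∈ Algebra.adjoin ℂ (Set.range ι ∪ {X c}) := fun b =>
    Algebra.subset_adjoin (Or.inl ⟨b, rfl⟩)
  have hX : X c ∈ Algebra.adjoin ℂ (Set.range ι ∪ {X c}) := Algebra.subset_adjoin (Or.inr rfl)
  obtain ⟨n, hn⟩ : ∃ n, n = r.length := ⟨_, rfl⟩
  induction n using Nat.strong_induction_on generalizing r β with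
  | _ n ih =>
  match r with
  | [] => exact hι β
  | [β₁] =>
    simp only [monoWord, List.map_cons, List.map_nil, wick_cons_nil]
    exact mul_mem (hι _) (sub_mem (mul_mem hX (hι _)) (hι _))
  | β₁ :: β₂ :: r =>
    have e1 := fun β => ih (r.length + 1) (by rw [hn]; simp) (β₂ :: r) β rfl
    have e2 := fun β => ih r.length (by rw [hn]; simp) r β rfl
    simp only [monoWord, List.map_cons, wick_cons_cons, if_true] at e1 e2 ⊢
    exact mul_mem (hι _) (sub_mem (sub_mem (mul_mem hX (e1 _)) (e1 _)) (e2 _))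

end Wick

/-! ## The vacuum expectation of a Wick product -/

theorem ncMonomial_zero {M : Type*} [Monoid M] {B : Type*} (ι : B → M) (X : Fin 0 → M)
    (b : ℕ → B) :
    ncMonomial ι X b = ι (b 0) := by
  simp [ncMonomial]

theorem ncMonomial_succ {M : Type*} [Monoid M] {B : Type*} (ι : B → M) {d : ℕ}
    (X : Fin (d + 1) → M) (b : ℕ → B) : ncMonomial ι X b =
      ι (b 0) * (X 0 * ncMonomial ι (fun i => X i.succ) fun n => b (n + 1)) := by
  simp [ncMonomial, List.ofFn_succ, mul_assoc]

theorem ncMonomial_update_zero {M : Type*} [Monoid M] {B : Type*} (ι : B → M) {d : ℕ}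
    (X : Fin d → M) (b : ℕ → B) (β : B) : ncMonomial ι X (Function.update b 0 β) =
      ι β * (List.ofFn fun i : Fin d => X i * ι (b (i + 1))).prod := by
  simp [ncMonomial]

theorem leftMul_one {B : Type v} [Monoid B] : WordSpace.leftMul (1 : B) = 1 := by
  refine Finsupp.lhom_ext' fun w => LinearMap.ext_ring ?_
  simp [WordSpace.leftMul]

theorem leftMul_mul {B : Type v} [Monoid B] (b b' : B) :
    WordSpace.leftMul (b * b') = WordSpace.leftMul b * WordSpace.leftMul b' := by
  refine Finsupp.lhom_ext' fun w => LinearMap.ext_ring ?_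
  simp [WordSpace.leftMul, mul_assoc]

section Vacuum

variable {A : Type u} {B : Type v} [CStarAlgebra A] [CStarAlgebra B] [PartialOrder B]
  [StarOrderedRing B]

variable (ι : B →⋆ₐ[ℂ] A) (x : A) (K : JacobiParams B)

/-- The polynomials in `x`, paired with their models on the space of words. -/
noncomputable def modelPairs : Submodule ℂ (A × Module.End ℂ (WordSpace B)) :=
  Submodule.span ℂ {p | ∃ (n : ℕ) (b : ℕ → B), p = (ncMonomial ι (fun _ : Fin n => x) b,
    ncMonomial WordSpace.leftMul (fun _ : Fin n => K.op) b)}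

theorem incl_mem_modelPairs (b : B) : (ι b, WordSpace.leftMul b) ∈ modelPairs ι x K :=
  Submodule.subset_span ⟨0, fun _ => b, by rw [ncMonomial_zero, ncMonomial_zero]⟩

theorem sub_mem_modelPairs {p q : A × Module.End ℂ (WordSpace B)}
    (hp : p ∈ modelPairs ι x K) (hq : q ∈ modelPairs ι x K) : p - q ∈ modelPairs ι x K := by
  have e : p - q = p + (-1 : ℂ) • q := by
    refine Prod.ext ?_ (LinearMap.ext fun ξ => ?_)
    · simp [sub_eq_add_neg]
    · simp [sub_eq_add_neg]
  rw [e]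
  exact add_mem hp (Submodule.smul_mem _ (-1) hq)

theorem var_mul_mem_modelPairs {p : A × Module.End ℂ (WordSpace B)}
    (hp : p ∈ modelPairs ι x K) : (x, K.op) * p ∈ modelPairs ι x K := by
  refine Submodule.span_induction (p := fun p _ => (x, K.op) * p ∈ modelPairs ι x K)
    ?_ ?_ ?_ ?_ hp
  · rintro _ ⟨n, b, rfl⟩
    refine Submodule.subset_span ⟨n + 1, fun n => n.casesOn 1 b, ?_⟩
    rw [ncMonomial_succ, ncMonomial_succ]
    simp [leftMul_one]
  · simp
  · intro p q _ _ hp hq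
    rw [mul_add]
    exact add_mem hp hq
  · intro a p _ hp
    rw [mul_smul_comm]
    exact Submodule.smul_mem _ a hp

theorem incl_mul_mem_modelPairs (b : B) {p : A × Module.End ℂ (WordSpace B)}
    (hp : p ∈ modelPairs ι x K) : (ι b, WordSpace.leftMul b) * p ∈ modelPairs ι x K := by
  refine Submodule.span_induction (p := fun p _ => (ι b, WordSpace.leftMul b) * p ∈
    modelPairs ι x K) ?_ ?_ ?_ ?_ hp
  · rintro _ ⟨n, b', rfl⟩
    refine Submodule.subset_span ⟨n, Function.update b' 0 (b * b' 0), ?_⟩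
    rw [ncMonomial_update_zero, ncMonomial_update_zero, map_mul, leftMul_mul]
    simp [ncMonomial, mul_assoc]
  · simp
  · intro p q _ _ hp hq
    rw [mul_add]
    exact add_mem hp hq
  · intro a p _ hp
    rw [mul_smul_comm]
    exact Submodule.smul_mem _ a hp

/-- The `B`-valued vacuum component of a vector. -/
noncomputable def vacuumPart : WordSpace B →ₗ[ℂ] B :=
  Finsupp.linearCombination ℂ fun w : B × List B => if w.2 = [] then w.1 else 0

theorem inner_vacuum (ξ : WordSpace B) :
    K.inner (Finsupp.single (1, []) 1) ξ = vacuumPart ξ := by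
  rw [JacobiParams.inner, Finsupp.sum_single_index (by simp), vacuumPart,
    Finsupp.linearCombination_apply]
  refine Finsupp.sum_congr fun w _ => ?_
  obtain ⟨β, r⟩ := w
  cases r <;> simp [JacobiParams.wordInner, JacobiParams.wordInnerAux]

variable {ι x K}

/-- Passing to the model is only a relation: `leftMul` is not additive in its coefficient, so
evaluation on words does not factor through `A`. The two expectations are nevertheless linear on
pairs and agree on monomials. -/
theorem map_fst_of_mem_modelPairs {E : A →ₗ[ℂ] B} (hx : IsJacobiSzego ι E x K)
    {p : A × Module.End ℂ (WordSpace B)} (hp : p ∈ modelPairs ι x K) :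
    E p.1 = vacuumPart (p.2 (Finsupp.single (1, []) 1)) := by
  refine Submodule.span_induction (p := fun p _ => E p.1 =
    vacuumPart (p.2 (Finsupp.single (1, []) 1))) ?_ ?_ ?_ ?_ hp
  · rintro _ ⟨n, b, rfl⟩
    rw [hx.2, JacobiParams.distr, inner_vacuum]
  · simp
  · intro p q _ _ hp hq
    simp [hp, hq]
  · intro a p _ hp
    simp [hp]

/-- The Wick recursion subtracts from `op` precisely its preservation and annihilation parts; in the
model only creation remains, and it builds the word letter by letter. -/
theorem exists_mem_modelPairs (X : Fin 2 → A) (J : Fin 2 → JacobiParams B) (c : Fin 2)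
    (r : List B) (β : B) : ∃ T, (wick ι X J (monoWord c r) β, T) ∈ modelPairs ι (X c) (J c) ∧
      T (Finsupp.single (1, []) 1) = Finsupp.single (β, r) 1 := by
  obtain ⟨n, hn⟩ : ∃ n, n = r.length := ⟨_, rfl⟩
  induction n using Nat.strong_induction_on generalizing r β with
  | _ n ih =>
  match r with
  | [] => exact ⟨_, incl_mem_modelPairs ι (X c) (J c) β, by simp [WordSpace.leftMul]⟩
  | [β₁] =>
    have h := incl_mul_mem_modelPairs ι (X c) (J c) β
      (sub_mem_modelPairs ι (X c) (J c) (var_mul_mem_modelPairs ι (X c) (J c)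
        (incl_mem_modelPairs ι (X c) (J c) β₁))
        (incl_mem_modelPairs ι (X c) (J c) ((J c).lam 1 * β₁)))
    refine ⟨WordSpace.leftMul β * ((J c).op * WordSpace.leftMul β₁ -
      WordSpace.leftMul ((J c).lam 1 * β₁)), ?_, ?_⟩
    · rw [show monoWord c [β₁] = [(c, β₁)] from rfl, wick_cons_nil]
      exact h
    simp [WordSpace.leftMul, JacobiParams.op, JacobiParams.create, JacobiParams.preserve,
      JacobiParams.annihilate]
  | β₁ :: β₂ :: r =>
    obtain ⟨T₁, h₁, hT₁⟩ := ih (r.length + 1) (by rw [hn]; simp) (β₂ :: r) β₁ rfl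
    obtain ⟨T₂, h₂, hT₂⟩ := ih (r.length + 1) (by rw [hn]; simp) (β₂ :: r)
      ((J c).lam (r.length + 1 + 1) * β₁) rfl
    obtain ⟨T₃, h₃, hT₃⟩ := ih r.length (by rw [hn]; simp) r
      ((J c).alpha (r.length + 1) β₁ * β₂) rfl
    refine ⟨WordSpace.leftMul β * ((J c).op * T₁ - T₂ - T₃), ?_, ?_⟩
    · have := incl_mul_mem_modelPairs ι (X c) (J c) β
        (sub_mem_modelPairs _ _ _ (sub_mem_modelPairs _ _ _ (var_mul_mem_modelPairs
          ι (X c) (J c) h₁) h₂) h₃)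
      have h3 := runDepth_monoWord c (β₂ :: r)
      have h4 := runDepth_monoWord c r
      simp only [monoWord, List.map_cons, List.length_cons] at h3 h4 this ⊢
      rw [wick_cons_cons, if_pos rfl, h3, h4]
      exact this
    · simp [hT₁, hT₂, hT₃, WordSpace.leftMul, JacobiParams.op, JacobiParams.create,
        JacobiParams.preserve, JacobiParams.annihilate]
      abel

theorem map_wick_monoWord {E : A →ₗ[ℂ] B} {X : Fin 2 → A} {J : Fin 2 → JacobiParams B}
    {c : Fin 2} (hX : IsJacobiSzego ι E (X c) (J c)) {r : List B} (hr : r ≠ []) (β : B) :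
    E (wick ι X J (monoWord c r) β) = 0 := by
  obtain ⟨T, hT, hT'⟩ := exists_mem_modelPairs (ι := ι) X J c r β
  rw [map_fst_of_mem_modelPairs hX hT, hT']
  simp [vacuumPart, hr]

end Vacuum

/-! ### Joint moments of free variables. -/

section FreeMoments

variable {A : Type u} {B : Type v} [CStarAlgebra A] [CStarAlgebra B]
  {ι : B →⋆ₐ[ℂ] A} {E : A →ₗ[ℂ] B} {X : Fin 2 → A}

theorem AreFree.map_list_prod (h : AreFree ι E X) {L : List (Fin 2 × A)} (hL : L ≠ [])
    (hmem : ∀ p ∈ L, p.2 ∈ Algebra.adjoin ℂ (Set.range ι ∪ {X p.1})) (h0 : ∀ p ∈ L, E p.2 = 0)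
    (hne : L.IsChain fun p q => p.1 ≠ q.1) : E (L.map Prod.snd).prod = 0 := by
  cases L with
  | nil => exact absurd rfl hL
  | cons x L =>
    have e : (x :: L).map Prod.snd = List.ofFn fun j : Fin (L.length + 1) => ((x :: L).get j).2 := by
      refine List.ext_getElem (by simp) fun n h1 h2 => ?_
      simp
    rw [e]
    refine h L.length (fun j => ((x :: L).get j).1) _ (fun j => hmem _ (List.get_mem _ _))
      (fun j => h0 _ (List.get_mem _ _)) fun j => ?_
    exact (List.isChain_iff_getElem.1 hne) j (by simp)

variable (ι X) in
/-- The product `b 0 * X_{ε 0} * b 1 * ⋯ * b (i - 1) * X_{ε (i - 1)}`. -/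
noncomputable def initialMonomial (ε : ℕ → Fin 2) (b : ℕ → B) : ℕ → A
  | 0 => 1
  | i + 1 => initialMonomial ε b i * ι (b i) * X (ε i)

theorem initialMonomial_mul (ε : ℕ → Fin 2) (b : ℕ → B) (d : ℕ) :
    initialMonomial ι X ε b d * ι (b d) = ncMonomial ι (fun i : Fin d => X (ε i)) b := by
  induction d with
  | zero => simp [initialMonomial, ncMonomial]
  | succ d ih =>
    rw [ncMonomial, List.ofFn_succ', List.prod_concat, ← mul_assoc]
    simp only [Fin.val_castSucc, Fin.val_last]
    rw [← ncMonomial, ← ih, initialMonomial, mul_assoc _ (X (ε d))]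

variable [PartialOrder B] [StarOrderedRing B] {J : Fin 2 → JacobiParams B}

theorem exists_monoWord_append {B : Type v} (c : Fin 2) (t : List (Fin 2 × B)) :
    ∃ r s, t = monoWord c r ++ s ∧ ∀ x ∈ s.head?, x.1 ≠ c := by
  induction t with
  | nil => exact ⟨[], [], rfl, by simp⟩
  | cons x t ih =>
    obtain ⟨c', β⟩ := x
    by_cases hc : c' = c
    · obtain ⟨r, s, rfl, hs⟩ := ih
      exact ⟨β :: r, s, by simp [monoWord, hc], hs⟩
    · exact ⟨[], (c', β) :: t, rfl, by simp [hc]⟩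

/-- The factors are the Wick products of the maximal runs. The first colour is recorded so that the
alternation survives when a further run is put in front. -/
theorem exists_wick_eq_list_prod (hX : ∀ i, IsJacobiSzego ι E (X i) (J i))
    (t : List (Fin 2 × B)) :
    ∃ L : List (Fin 2 × A), wick ι X J t 1 = (L.map Prod.snd).prod ∧
      (∀ p ∈ L, p.2 ∈ Algebra.adjoin ℂ (Set.range ι ∪ {X p.1})) ∧ (∀ p ∈ L, E p.2 = 0) ∧
      (L.IsChain fun p q => p.1 ≠ q.1) ∧ L.head?.map Prod.fst = t.head?.map Prod.fst := by
  obtain ⟨n, hn⟩ : ∃ n, n = t.length := ⟨_, rfl⟩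
  induction n using Nat.strong_induction_on generalizing t with
  | _ n ih =>
  match t with
  | [] => exact ⟨[], by simp [wick_nil]⟩
  | (c, β) :: t =>
    obtain ⟨r, s, rfl, hs⟩ := exists_monoWord_append c t
    obtain ⟨L, h1, h2, h3, h4, h5⟩ := ih s.length (by rw [hn]; simp) s rfl
    refine ⟨(c, wick ι X J (monoWord c (β :: r)) 1) :: L, ?_, ?_, ?_, ?_, by simp⟩
    · have := wick_monoWord_append ι X J c (β :: r) hs 1
      rw [List.map_cons, List.prod_cons, ← h1, ← this]
      rfl
    · simp only [List.mem_cons, forall_eq_or_imp]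
      exact ⟨wick_monoWord_mem_adjoin ι X J c _ _, h2⟩
    · simp only [List.mem_cons, forall_eq_or_imp]
      exact ⟨map_wick_monoWord (hX c) (by simp) _, h3⟩
    · refine List.isChain_cons.2 ⟨fun y hy => ?_, h4⟩
      rw [Option.mem_def] at hy
      rw [hy] at h5
      cases s with
      | nil => simp at h5
      | cons z s =>
        have := hs z (by simp)
        simp at h5
        rw [h5]
        exact this.symm

theorem map_wick_cons (hE : IsCondExp ι E) (hX : ∀ i, IsJacobiSzego ι E (X i) (J i))
    (hfree : AreFree ι E X) (x : Fin 2 × B) (t : List (Fin 2 × B)) (β : B) :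
    E (wick ι X J (x :: t) β) = 0 := by
  obtain ⟨L, h1, h2, h3, h4, h5⟩ := exists_wick_eq_list_prod hX (x :: t)
  have hL : L ≠ [] := by rintro rfl; simp at h5
  have := hE.map_bimod β (wick ι X J (x :: t) 1) 1
  rw [map_one, mul_one, mul_one, ← wick_eq_mul] at this
  rw [this, h1, hfree.map_list_prod hL h2 h3 h4, mul_zero]

variable (ε : ℕ → Fin 2) (b : ℕ → B)

theorem map_mul_wick_add (M : A) (t : List (Fin 2 × B)) (x y : B) :
    E (M * wick ι X J t (x + y)) = E (M * wick ι X J t x) + E (M * wick ι X J t y) := by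
  rw [wick_eq_mul, wick_eq_mul ι X J t x, wick_eq_mul ι X J t y, map_add, add_mul, mul_add,
    map_add]

theorem map_mul_wick_sum {S : Type*} (s : Finset S) (f : S → B) (M : A) (t : List (Fin 2 × B)) :
    E (M * wick ι X J t (∑ x ∈ s, f x)) = ∑ x ∈ s, E (M * wick ι X J t (f x)) := by
  rw [wick_eq_mul, map_sum, Finset.sum_mul, Finset.mul_sum, map_sum]
  exact Finset.sum_congr rfl fun x _ => by rw [wick_eq_mul ι X J t (f x)]

/-- The last variable closes a pair: it is annihilated by an earlier one. -/
theorem map_initialMonomial_mul_wick_cons (hE : IsCondExp ι E)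
    (hX : ∀ i, IsJacobiSzego ι E (X i) (J i)) (hfree : AreFree ι E X) (i : ℕ) (c : Fin 2)
    (β₁ : B) (t : List (Fin 2 × B)) (β : B) :
    E (initialMonomial ι X ε b i * wick ι X J ((c, β₁) :: t) β) =
      ∑ p ∈ Finset.range i, if ε p = c then
        E (initialMonomial ι X ε b p * wick ι X J t (b p * (J c).alpha (runDepth c t)
          (nestedSum J ε b (fun c' => runDepth c' ((c, β₁) :: t)) (p + 1) i β) * β₁)) else 0 := by
  induction i using Nat.strong_induction_on generalizing c β₁ t β with
  | _ i ih =>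
  cases i with
  -- With no variable left to annihilate the letter, the expectation is zero; this is where freeness
  -- enters.
  | zero => simp [initialMonomial, map_wick_cons hE hX hfree]
  | succ i =>
    set D : Fin 2 → ℕ := fun c' => runDepth c' ((c, β₁) :: t) with hD
    -- The rightmost remaining variable creates a letter, preserves the word, or annihilates its
    -- first letter.
    have e1 : initialMonomial ι X ε b (i + 1) * wick ι X J ((c, β₁) :: t) β =
        initialMonomial ι X ε b i * wick ι X J ((ε i, β) :: (c, β₁) :: t) (b i) +
        initialMonomial ι X ε b i *
          wick ι X J ((c, β₁) :: t) (b i * (J (ε i)).lam (D (ε i)) * β) +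
        if ε i = c then initialMonomial ι X ε b i *
          wick ι X J t (b i * (J c).alpha (runDepth c t) β * β₁) else 0 := by
      rw [initialMonomial, mul_assoc, X_mul_wick_cons, mul_assoc, mul_add, mul_add, mul_add,
        mul_add, incl_mul_wick, incl_mul_wick, mul_one, ← mul_assoc (b i)]
      congr 1
      by_cases hc : ε i = c
      · rw [if_pos hc, if_pos hc.symm, incl_mul_wick, hc, mul_assoc (b i)]
      · rw [if_neg hc, if_neg (Ne.symm hc), mul_zero, mul_zero]
    have e2 : ∀ p ∈ Finset.range i, (if ε p = c then
        E (initialMonomial ι X ε b p * wick ι X J t (b p * (J c).alpha (runDepth c t)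
          (nestedSum J ε b D (p + 1) (i + 1) β) * β₁)) else 0) =
        (if ε p = c then
        E (initialMonomial ι X ε b p * wick ι X J t (b p * (J c).alpha (runDepth c t)
          (nestedSum J ε b D (p + 1) i (b i * (J (ε i)).lam (D (ε i)) * β)) * β₁)) else 0) +
        ∑ q ∈ Finset.Ico (p + 1) i, if ε q = ε i then (if ε p = c then
          E (initialMonomial ι X ε b p * wick ι X J t (b p * (J c).alpha (runDepth c t)
            (nestedSum J ε b D (p + 1) q (b q * (J (ε i)).alpha (D (ε i))
              (nestedSum J ε b (innerDepth D (ε i)) (q + 1) i (b i)) * β)) * β₁)) else 0)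
          else 0 := by
      intro p hp
      by_cases hc : ε p = c
      · simp only [if_pos hc]
        rw [nestedSum_succ_right J ε b D (Finset.mem_range.1 hp), map_add, mul_add, add_mul,
          map_mul_wick_add, map_sum, Finset.mul_sum, Finset.sum_mul, map_mul_wick_sum]
        congr 1
        refine Finset.sum_congr rfl fun q _ => ?_
        split_ifs with hq
        · rfl
        · simp [wick_eq_mul ι X J t 0]
      · simp [hc]
    -- Two uses of the induction hypothesis: the new letter is annihilated at `q`, then the old
    -- first letter at some `p < q`.
    have e3 : E (initialMonomial ι X ε b i * wick ι X J ((ε i, β) :: (c, β₁) :: t) (b i)) =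
        ∑ q ∈ Finset.range i, ∑ p ∈ Finset.range q, if ε q = ε i then (if ε p = c then
          E (initialMonomial ι X ε b p * wick ι X J t (b p * (J c).alpha (runDepth c t)
            (nestedSum J ε b D (p + 1) q (b q * (J (ε i)).alpha (D (ε i))
              (nestedSum J ε b (innerDepth D (ε i)) (q + 1) i (b i)) * β)) * β₁)) else 0)
          else 0 := by
      rw [ih i (Nat.lt_succ_self i), runDepth_cons]
      refine Finset.sum_congr rfl fun q hq => ?_
      split_ifs with hc
      · rw [ih q (by have := Finset.mem_range.1 hq; omega)]
      · simp
    rw [e1, map_add, map_add, e3, ih i (Nat.lt_succ_self i), Finset.sum_range_succ,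
      Finset.sum_congr rfl e2, Finset.sum_add_distrib, nestedSum_self,
      Finset.sum_comm' (s := Finset.range i) (t := fun q => Finset.range q)
      (t' := Finset.range i) (s' := fun p => Finset.Ico (p + 1) i)
      (by intro x y; simp only [Finset.mem_range, Finset.mem_Ico]; omega)]
    rw [add_comm (∑ p ∈ Finset.range i, ∑ q ∈ _, _)]
    congr 1
    split_ifs <;> simp

/-- The last position is a singleton (preservation) or closes a pair opened at some `p` (creation,
annihilated at `p`), which is the recursion of `nestedSum_succ_right`. -/
theorem map_initialMonomial_mul_incl (hE : IsCondExp ι E)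
    (hX : ∀ i, IsJacobiSzego ι E (X i) (J i)) (hfree : AreFree ι E X) (i : ℕ) (β : B) :
    E (initialMonomial ι X ε b i * ι β) = nestedSum J ε b (fun _ => 1) 0 i β := by
  induction i using Nat.strong_induction_on generalizing β with
  | _ i ih =>
  cases i with
  | zero => simp [initialMonomial, nestedSum_self, hE.map_incl]
  | succ i =>
    have e1 : initialMonomial ι X ε b (i + 1) * ι β =
        initialMonomial ι X ε b i * wick ι X J [(ε i, β)] (b i) +
        initialMonomial ι X ε b i * ι (b i * (J (ε i)).lam 1 * β) := by
      have := X_mul_wick_nil ι X J (ε i) β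
      rw [wick_nil, wick_nil] at this
      rw [initialMonomial, mul_assoc, this, mul_assoc, mul_add, mul_add, incl_mul_wick, mul_one,
        ← map_mul, ← mul_assoc (b i)]
    rw [e1, map_add, ih i (Nat.lt_succ_self i), nestedSum_succ_right J ε b _ (Nat.zero_le i),
      add_comm, map_initialMonomial_mul_wick_cons ε b hE hX hfree, runDepth_cons,
      Finset.range_eq_Ico]
    congr 1
    refine Finset.sum_congr rfl fun p hp => ?_
    split_ifs with hc
    · rw [wick_nil, ih p (by have := Finset.mem_Ico.1 hp; omega)]
      rfl
    · rfl

/-- The joint moments of two free variables, as sums over two-colour partitions. -/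
theorem map_ncMonomial_eq_sum (hE : IsCondExp ι E)
    (hX : ∀ i, IsJacobiSzego ι E (X i) (J i)) (hfree : AreFree ι E X) {d : ℕ} (ε : Fin d → Fin 2) :
    E (ncMonomial ι (fun i => X (ε i)) b) =
      ∑ π : TCNC d with π.color = ε, π.moment J b := by
  obtain ⟨ε', rfl⟩ : ∃ ε' : ℕ → Fin 2, ε = fun x : Fin d => ε' x :=
    ⟨fun n => if h : n < d then ε ⟨n, h⟩ else 0, by simp⟩
  rw [TCNC.sum_moment, ← initialMonomial_mul, map_initialMonomial_mul_incl ε' b hE hX hfree]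

theorem sum_moment_eq_sum_relDepth {k l : ℕ} (hk : (J 0).HasDepth k) (hl : (J 1).HasDepth l)
    {d : ℕ} (ε : Fin d → Fin 2) :
    ∑ π : TCNC d with π.color = ε, π.moment J b =
      ∑ π ∈ TCNC.relDepth k l d with π.color = ε, π.moment J b := by
  symm
  refine Finset.sum_subset (Finset.filter_subset_filter _ (Finset.subset_univ _)) ?_
  intro π h1 h2
  rw [Finset.mem_filter] at h1 h2
  exact TCNC.moment_eq_zero_of_notMem_relDepth hk hl b fun h => h2 ⟨h, h1.2⟩

end FreeMoments

/-! ## The scalar case -/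

section Scalar

open scoped ComplexOrder

/-- The Jacobi parameters of the distribution of `pathMatrix k`. -/
noncomputable def pathJacobi (k : ℕ) : JacobiParams ℂ where
  lam _ := 0
  alpha i := if i < k then
      { LinearMap.id with map_cstarMatrix_nonneg' := fun _ _ hM => hM }
    else
      { (0 : ℂ →ₗ[ℂ] ℂ) with map_cstarMatrix_nonneg' := fun _ _ _ => le_of_eq (by ext; rfl) }
  isSelfAdjoint_lam _ := IsSelfAdjoint.zero _

theorem pathJacobi_alpha_of_lt {i k : ℕ} (h : i < k) (z : ℂ) :
    (pathJacobi k).alpha i z = z := by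
  simp only [pathJacobi, if_pos h]
  rfl

theorem pathJacobi_alpha_of_le {i k : ℕ} (h : k ≤ i) (z : ℂ) :
    (pathJacobi k).alpha i z = 0 := by
  simp only [pathJacobi, if_neg (not_lt.2 h)]
  rfl

theorem pathJacobi_hasDepth (k : ℕ) : (pathJacobi k).HasDepth k :=
  ⟨fun _ _ => rfl, fun _ h z => pathJacobi_alpha_of_le h z⟩

/-- The space of words, mapped to the space on which `pathMatrix k` acts. -/
noncomputable def pathModel (k : ℕ) : WordSpace ℂ →ₗ[ℂ] (Fin k → ℂ) :=
  Finsupp.linearCombination ℂ fun w : ℂ × List ℂ =>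
    if h : w.2.length < k then Pi.single ⟨w.2.length, h⟩ (w.1 * w.2.prod) else 0

theorem pathModel_single {k : ℕ} (w : ℂ × List ℂ) :
    pathModel k (Finsupp.single w 1) =
      if h : w.2.length < k then Pi.single ⟨w.2.length, h⟩ (w.1 * w.2.prod) else 0 := by
  simp [pathModel]

theorem pathMatrix_mulVec_single {k : ℕ} (i : Fin k) (z : ℂ) :
    (pathMatrix k).mulVec (Pi.single i z) = fun j : Fin k =>
      (if (j : ℕ) = i + 1 then z else 0) + if (j : ℕ) + 1 = i then z else 0 := by
  funext j
  rw [Matrix.mulVec_single]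
  simp only [pathMatrix, Pi.smul_apply, Matrix.col_apply, Matrix.of_apply,
    MulOpposite.smul_eq_mul_unop, MulOpposite.unop_op]
  have : ¬ ((j : ℕ) = i + 1 ∧ (j : ℕ) + 1 = i) := by omega
  by_cases h1 : (j : ℕ) = i + 1
  · have h2 : ¬ ((j : ℕ) + 1 = i) := by omega
    simp [h1]
    omega
  · have h2 : ¬ ((i : ℕ) + 1 = j) := by omega
    by_cases h3 : (j : ℕ) + 1 = i <;> simp [h1, h2, h3]

/-- Words of length `n < k` become multiples of the basis vector `n`; creation and annihilation walk
along the edges of the path. Dropping longer words is consistent, because `alpha i = 0` for `i ≥ k`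
lets none of them return. -/
theorem pathModel_op {k : ℕ} (ξ : WordSpace ℂ) :
    pathModel k ((pathJacobi k).op ξ) = (pathMatrix k).mulVec (pathModel k ξ) := by
  have : pathModel k ∘ₗ (pathJacobi k).op = (pathMatrix k).mulVecLin ∘ₗ pathModel k := by
    refine Finsupp.lhom_ext' fun w => LinearMap.ext_ring ?_
    obtain ⟨z, r⟩ := w
    simp only [LinearMap.comp_apply, Finsupp.lsingle_apply, Matrix.mulVecLin_apply,
      JacobiParams.op, LinearMap.add_apply, map_add, JacobiParams.create, JacobiParams.preserve,
      JacobiParams.annihilate, Finsupp.linearCombination_single, one_smul, pathModel_single,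
      List.length_cons, List.prod_cons, one_mul]
    cases r with
    | nil =>
      by_cases h0 : 0 < k
      · simp only [List.length_nil, h0, dif_pos, pathMatrix_mulVec_single]
        funext j
        by_cases h1 : 0 + 1 < k
        · simp [h1, Pi.single_apply, Fin.ext_iff, pathJacobi]
        · have : (j : ℕ) ≠ 1 := by omega
          simp [h1, this, pathJacobi]
      · have : ¬ 0 + 1 < k := by omega
        simp [h0, this]
    | cons z' r =>
      simp only [List.length_cons, List.prod_cons, pathModel_single]
      by_cases h0 : r.length + 1 < k
      · simp only [h0, dif_pos, pathMatrix_mulVec_single, pathJacobi_alpha_of_lt h0,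
          show r.length < k by omega]
        funext j
        by_cases h1 : r.length + 1 + 1 < k
        · simp [h1, Pi.single_apply, Fin.ext_iff, pathJacobi, mul_assoc]
        · have : (j : ℕ) ≠ r.length + 1 + 1 := by omega
          simp [h1, this, Pi.single_apply, Fin.ext_iff, pathJacobi, mul_assoc]
      · have h1 : ¬ r.length + 1 + 1 < k := by omega
        simp [h0, h1, pathJacobi_alpha_of_le (not_lt.1 h0)]
  exact LinearMap.congr_fun this ξ

theorem pathModel_leftMul {k : ℕ} (z : ℂ) (ξ : WordSpace ℂ) :
    pathModel k (WordSpace.leftMul z ξ) = z • pathModel k ξ := by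
  have : pathModel k ∘ₗ WordSpace.leftMul z = z • pathModel k := by
    refine Finsupp.lhom_ext' fun w => LinearMap.ext_ring ?_
    simp only [LinearMap.comp_apply, Finsupp.lsingle_apply, WordSpace.leftMul,
      Finsupp.linearCombination_single, one_smul, pathModel_single, LinearMap.smul_apply]
    split_ifs with h
    · rw [← Pi.single_smul, smul_eq_mul, mul_assoc]
    · rw [smul_zero]
  exact LinearMap.congr_fun this ξ

theorem pathModel_ncMonomial {k : ℕ} (n : ℕ) (b : ℕ → ℂ) (ξ : WordSpace ℂ) :
    pathModel k (ncMonomial WordSpace.leftMul (fun _ : Fin n => (pathJacobi k).op) b ξ) =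
      (∏ i ∈ Finset.range (n + 1), b i) • (pathMatrix k ^ n).mulVec (pathModel k ξ) := by
  induction n generalizing b with
  | zero => simp [ncMonomial_zero, pathModel_leftMul]
  | succ n ih =>
    rw [ncMonomial_succ, Module.End.mul_apply, Module.End.mul_apply, pathModel_leftMul,
      pathModel_op, ih, Matrix.mulVec_smul, Matrix.mulVec_mulVec, ← pow_succ', smul_smul,
      Finset.prod_range_succ' _ (n + 1), mul_comm (b 0)]

theorem pathJacobi_distr {k : ℕ} (hk : 0 < k) (n : ℕ) (b : ℕ → ℂ) :
    (pathJacobi k).distr n b =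
      (∏ i ∈ Finset.range (n + 1), b i) * (pathMatrix k ^ n) ⟨0, hk⟩ ⟨0, hk⟩ := by
  have h : ∀ ξ : WordSpace ℂ, vacuumPart ξ = pathModel k ξ ⟨0, hk⟩ := by
    intro ξ
    have : vacuumPart = LinearMap.proj ⟨0, hk⟩ ∘ₗ pathModel k := by
      refine Finsupp.lhom_ext' fun w => LinearMap.ext_ring ?_
      obtain ⟨z, r⟩ := w
      cases r with
      | nil => simp [vacuumPart, pathModel_single, hk]
      | cons z' r =>
        simp only [vacuumPart, LinearMap.comp_apply, Finsupp.lsingle_apply,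
          Finsupp.linearCombination_single, pathModel_single]
        split_ifs <;> simp_all
    rw [this]
    rfl
  rw [JacobiParams.distr, inner_vacuum, h, pathModel_ncMonomial, pathModel_single]
  simp [hk, Matrix.mulVec_single]

theorem ncMonomial_scalar {A : Type u} [CStarAlgebra A] {d : ℕ} (x : Fin d → A) (b : ℕ → ℂ) :
    ncMonomial (StarAlgHom.ofId ℂ A) x b =
      (∏ i ∈ Finset.range (d + 1), b i) • (List.ofFn x).prod := by
  induction d generalizing b with
  | zero => simp [ncMonomial_zero, StarAlgHom.ofId_apply, Algebra.algebraMap_eq_smul_one]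
  | succ d ih =>
    rw [ncMonomial_succ, ih, StarAlgHom.ofId_apply, Algebra.algebraMap_eq_smul_one,
      List.ofFn_succ, List.prod_cons, Finset.prod_range_succ' _ (d + 1), mul_comm _ (b 0),
      smul_one_mul, mul_smul_comm, smul_smul]

theorem isJacobiSzego_pathJacobi {A : Type u} [CStarAlgebra A] {φ : A →ₗ[ℂ] ℂ} {x : A} {k : ℕ}
    (hk : 0 < k) (hx : IsSelfAdjoint x)
    (h : ∀ n, φ (x ^ n) = (pathMatrix k ^ n) ⟨0, hk⟩ ⟨0, hk⟩) :
    IsJacobiSzego (StarAlgHom.ofId ℂ A) φ x (pathJacobi k) :=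
  ⟨hx, fun n b => by
    rw [ncMonomial_scalar, pathJacobi_distr hk, map_smul, List.ofFn_const, List.prod_replicate,
      h, smul_eq_mul]⟩

end Scalar

/-! ## The measure `pathMeasure` -/

section PathMeasure

/-- Diagonalisation in the orthonormal eigenbasis: the weights are the squared moduli of the `i`-th
coordinates. -/
theorem pathMatrix_pow_apply {k : ℕ} (n : ℕ) (i : Fin k) :
    (pathMatrix k ^ n) i i = ((∑ j : Fin k,
      ‖(isHermitian_pathMatrix k).eigenvectorBasis j i‖ ^ 2 *
        (isHermitian_pathMatrix k).eigenvalues j ^ n : ℝ) : ℂ) := by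
  have h := (isHermitian_pathMatrix k).spectral_theorem
  have h' : pathMatrix k ^ n = Unitary.conjStarAlgAut ℂ _
      (isHermitian_pathMatrix k).eigenvectorUnitary (Matrix.diagonal
        (RCLike.ofReal ∘ (isHermitian_pathMatrix k).eigenvalues) ^ n) := by
    rw [map_pow, ← h]
  rw [h', Unitary.conjStarAlgAut_apply, Matrix.diagonal_pow, Matrix.mul_apply]
  push_cast
  refine Finset.sum_congr rfl fun j _ => ?_
  rw [Matrix.mul_diagonal]
  simp only [Matrix.IsHermitian.eigenvectorUnitary_apply, Pi.pow_apply, Function.comp_apply,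
    Matrix.star_apply]
  rw [mul_right_comm]
  congr 1
  exact RCLike.mul_conj _

theorem integrable_pathMeasure {k : ℕ} (f : ℝ → ℝ) :
    Integrable f (pathMeasure k) := by
  rw [pathMeasure, integrable_finsetSum_measure]
  intro j _
  refine Integrable.smul_measure ?_ ENNReal.ofReal_ne_top
  exact integrable_dirac (by simp)

theorem integral_pathMeasure {k : ℕ} (f : ℝ → ℝ) :
    ∫ t, f t ∂(pathMeasure k) = ∑ j : Fin k,
      ‖(isHermitian_pathMatrix k).eigenvectorBasis j ⟨0, j.pos⟩‖ ^ 2 *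
        f ((isHermitian_pathMatrix k).eigenvalues j) := by
  rw [pathMeasure, integral_finsetSum_measure]
  · refine Finset.sum_congr rfl fun j _ => ?_
    rw [integral_smul_measure, integral_dirac, ENNReal.toReal_ofReal (by positivity), smul_eq_mul]
  · intro j _
    refine Integrable.smul_measure ?_ ENNReal.ofReal_ne_top
    exact integrable_dirac (by simp)

theorem integral_pow_pathMeasure {k : ℕ} (hk : 0 < k) (n : ℕ) :
    ((∫ t, t ^ n ∂(pathMeasure k) : ℝ) : ℂ) = (pathMatrix k ^ n) ⟨0, hk⟩ ⟨0, hk⟩ := by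
  rw [pathMatrix_pow_apply, integral_pathMeasure]

theorem isProbabilityMeasure_pathMeasure {k : ℕ} (hk : 0 < k) :
    IsProbabilityMeasure (pathMeasure k) := by
  -- The zeroth moment says that the weights sum to one.
  have h := pathMatrix_pow_apply 0 (⟨0, hk⟩ : Fin k)
  simp only [pow_zero, Matrix.one_apply_eq, mul_one] at h
  have h' : ∑ j : Fin k, ‖(isHermitian_pathMatrix k).eigenvectorBasis j ⟨0, hk⟩‖ ^ 2 = 1 := by
    exact_mod_cast h.symm
  refine ⟨?_⟩
  rw [pathMeasure, Measure.finsetSum_apply]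
  simp only [Measure.smul_apply, measure_univ, smul_eq_mul, mul_one]
  rw [← ENNReal.ofReal_sum_of_nonneg fun _ _ => by positivity, h', ENNReal.ofReal_one]

end PathMeasure

/-! ## Counting pairings -/

section Counting

theorem add_pow_eq_sum {A : Type*} [Ring A] (X : Fin 2 → A) (n : ℕ) :
    (X 0 + X 1) ^ n = ∑ ε : Fin n → Fin 2, (List.ofFn fun i => X (ε i)).prod := by
  induction n with
  | zero => simp
  | succ n ih =>
    rw [pow_succ', ih, ← (Fin.consEquiv fun _ => Fin 2).sum_comp, Fintype.sum_prod_type,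
      Fin.sum_univ_two, add_mul, Finset.mul_sum, Finset.mul_sum]
    simp [Fin.consEquiv, List.ofFn_succ]

open scoped ComplexOrder in
-- A singleton brings in `lam = 0`; without singletons, every `alpha` met has index below the bound
-- of its colour and is the identity.
theorem moment_pathJacobi {k l d : ℕ} (hk : 0 < k) (hl : 0 < l) {π : TCNC d}
    (hπ : π ∈ TCNC.relDepth k l d) :
    π.moment ![pathJacobi k, pathJacobi l] (fun _ => 1) = if ∀ i, π.mate i ≠ i then 1 else 0 := by
  split_ifs with h
  · refine TCNC.segment_eq_one _ _ (fun _ => rfl) (fun x hx => ?_) h (Nat.zero_le d)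
      π.isLevel_zero
    rw [TCNC.mem_relDepth] at hπ
    rcases Fin.exists_fin_two.1 ⟨π.color x, rfl⟩ with hc | hc
    · rw [hc]
      exact pathJacobi_alpha_of_lt (TCNC.depth_lt_of_depthLT hk hπ.1 ⟨hc, hx⟩) 1
    · rw [hc]
      exact pathJacobi_alpha_of_lt (TCNC.depth_lt_of_depthLT hl hπ.2 ⟨hc, hx⟩) 1
  · push Not at h
    obtain ⟨x, hx⟩ := h
    refine TCNC.moment_eq_zero _ _ (x := x) (Or.inl ⟨hx, ?_⟩)
    rcases Fin.exists_fin_two.1 ⟨π.color x, rfl⟩ with hc | hc <;> rw [hc] <;> rfl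

open scoped ComplexOrder in
theorem card_pairings_eq_integral {k l : ℕ} (hk : 0 < k) (hl : 0 < l) {ρ : Measure ℝ}
    (h : IsFreeConvolution.{u} (pathMeasure k) (pathMeasure l) ρ) (d : ℕ) :
    ((TCNC.pairings k l d).card : ℝ) = ∫ t, t ^ d ∂ρ := by
  obtain ⟨A, _, φ, X, hφ, hfree, hsa, h0, h1, hρ⟩ := h
  have hX : ∀ i, IsJacobiSzego (StarAlgHom.ofId ℂ A) φ (X i)
      ((![pathJacobi k, pathJacobi l] : Fin 2 → JacobiParams ℂ) i) := by
    rw [Fin.forall_fin_two]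
    exact ⟨isJacobiSzego_pathJacobi hk (hsa 0) fun n => by
        rw [(h0.2 n).2, integral_pow_pathMeasure hk],
      isJacobiSzego_pathJacobi hl (hsa 1) fun n => by
        rw [(h1.2 n).2, integral_pow_pathMeasure hl]⟩
  have key : ∀ ε : Fin d → Fin 2, φ (List.ofFn fun i => X (ε i)).prod =
      ∑ π ∈ TCNC.relDepth k l d with π.color = ε,
        if ∀ i, π.mate i ≠ i then (1 : ℂ) else 0 := by
    intro ε
    have := map_ncMonomial_eq_sum (fun _ => 1) hφ hX hfree ε
    rw [sum_moment_eq_sum_relDepth (k := k) (l := l) _ (pathJacobi_hasDepth k)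
      (pathJacobi_hasDepth l), ncMonomial_scalar, Finset.prod_const_one, one_smul] at this
    rw [this]
    exact Finset.sum_congr rfl fun π hπ => moment_pathJacobi hk hl (Finset.mem_filter.1 hπ).1
  have e := (hρ.2 d).2
  rw [add_pow_eq_sum, map_sum, Finset.sum_congr rfl fun ε _ => key ε, Finset.sum_fiberwise,
    ← Finset.sum_filter, Finset.sum_const, nsmul_eq_mul, mul_one] at e
  exact_mod_cast e

end Counting

/-! ## Distributions of self-adjoint elements -/

section Distribution

open scoped ComplexOrder

variable {A : Type u} [CStarAlgebra A] {φ : A →ₗ[ℂ] ℂ}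

theorem IsCondExp.map_one' (hφ : IsCondExp (StarAlgHom.ofId ℂ A) φ) : φ 1 = 1 := by
  simpa using hφ.map_incl 1

/-- Positivity controls squares only, and `(1 + a)² - (1 - a)² = 4a` expresses `a` through two of
them. -/
theorem IsCondExp.im_eq_zero (hφ : IsCondExp (StarAlgHom.ofId ℂ A) φ) {a : A}
    (ha : IsSelfAdjoint a) : (φ a).im = 0 := by
  have h1 := (Complex.nonneg_iff.1 (hφ.map_nonneg (1 + a))).2
  have h2 := (Complex.nonneg_iff.1 (hφ.map_nonneg (1 - a))).2
  have e : φ (star (1 + a) * (1 + a)) - φ (star (1 - a) * (1 - a)) = 4 * φ a := by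
    rw [star_add, star_sub, star_one, ha.star_eq, ← map_sub,
      show (1 + a) * (1 + a) - (1 - a) * (1 - a) = (4 : ℂ) • a by
        rw [show (4 : ℂ) • a = a + a + a + a by
          rw [show (4 : ℂ) = 1 + 1 + 1 + 1 by norm_num]; simp [add_smul]]
        noncomm_ring, map_smul, smul_eq_mul]
  have := congrArg Complex.im e
  rw [Complex.sub_im, ← h1, ← h2] at this
  simpa using this.symm

open scoped CompactlySupported in
/-- The state `φ`, as a positive functional on the continuous functions on the spectrum. -/
noncomputable def spectralFunctional (hφ : IsCondExp (StarAlgHom.ofId ℂ A) φ) {a : A}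
    (ha : IsSelfAdjoint a) : C_c(spectrum ℝ a, ℝ) →ₚ[ℝ] ℝ :=
  PositiveLinearMap.mk₀
    { toFun := fun f => (φ (cfcHom (R := ℝ) ha f.toContinuousMap)).re
      map_add' := fun f g => by
        have : (f + g).toContinuousMap = f.toContinuousMap + g.toContinuousMap := rfl
        rw [this, map_add, map_add, Complex.add_re]
      map_smul' := fun r f => by
        have : (r • f).toContinuousMap = r • f.toContinuousMap := rfl
        rw [this, map_smul, ← Complex.coe_smul, map_smul]
        simp }
    (fun f hf => by
      -- A nonnegative `f` is the square of a continuous function, so its image under the functional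
      -- calculus has the form `star y * y`.
      have hs : Continuous fun x => Real.sqrt (f x) := Real.continuous_sqrt.comp f.continuous
      have e : f.toContinuousMap = star (⟨_, hs⟩ : C(spectrum ℝ a, ℝ)) * ⟨_, hs⟩ := by
        ext x
        simpa using (Real.mul_self_sqrt (hf x)).symm
      change 0 ≤ (φ (cfcHom (R := ℝ) ha f.toContinuousMap)).re
      rw [e, map_mul, map_star]
      exact (Complex.nonneg_iff.1 (hφ.map_nonneg _)).1)

/-- The Riesz measure of `φ` on the compact spectrum, pushed forward to the line; the functional
calculus turns the coordinate function into `a`. -/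
theorem exists_hasDistribution (hφ : IsCondExp (StarAlgHom.ofId ℂ A) φ) {a : A}
    (ha : IsSelfAdjoint a) : ∃ ρ, HasDistribution φ a ρ := by
  let μ := RealRMK.rieszMeasure (spectralFunctional hφ ha)
  have key : ∀ n : ℕ, ∫ x : spectrum ℝ a, (x : ℝ) ^ n ∂μ = (φ (a ^ n)).re := by
    intro n
    let g : C(spectrum ℝ a, ℝ) := ((ContinuousMap.id ℝ).restrict (spectrum ℝ a)) ^ n
    have h := RealRMK.integral_rieszMeasure (spectralFunctional hφ ha)
      (CompactlySupportedContinuousMap.continuousMapEquiv g)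
    have h2 : spectralFunctional hφ ha (CompactlySupportedContinuousMap.continuousMapEquiv g) =
        (φ (cfcHom (R := ℝ) ha g)).re := rfl
    have h3 : cfcHom (R := ℝ) ha g = a ^ n := by
      rw [show g = ((ContinuousMap.id ℝ).restrict (spectrum ℝ a)) ^ n from rfl, map_pow, cfcHom_id]
    rw [h2, h3] at h
    rw [← h]
    rfl
  have hprob : IsProbabilityMeasure μ := by
    have h := key 0
    simp only [pow_zero, hφ.map_one', Complex.one_re, integral_const, smul_eq_mul, mul_one] at h
    exact ⟨(ENNReal.toReal_eq_one_iff _).1 h⟩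
  refine ⟨μ.map Subtype.val, Measure.isProbabilityMeasure_map measurable_subtype_coe.aemeasurable,
    fun n => ⟨?_, ?_⟩⟩
  · rw [integrable_map_measure (continuous_pow n).aestronglyMeasurable
      measurable_subtype_coe.aemeasurable]
    have hc : Continuous fun x : spectrum ℝ a => (x : ℝ) ^ n := by fun_prop
    exact hc.integrable_of_hasCompactSupport (HasCompactSupport.of_compactSpace _)
  · rw [integral_map measurable_subtype_coe.aemeasurable
      (continuous_pow n).aestronglyMeasurable, key]
    exact Complex.ext rfl (hφ.im_eq_zero (ha.pow n))

end Distribution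

/-! ## Weighted shifts on `ℓ²` -/

section Shift

variable {α : Type u}

/-- The Hilbert space of square-summable functions on `α`. -/
abbrev L2Space (α : Type u) : Type u := lp (fun _ : α => ℂ) 2

open Classical in
/-- Composition with an injective map on the set `P`, and `0` elsewhere. -/
noncomputable def partialComp {σ : α → α} (hσ : Function.Injective σ) (P : α → Prop) :
    L2Space α →L[ℂ] L2Space α :=
  have hs : ∀ (f : L2Space α) (s : Finset α),
      ∑ i ∈ s, ‖(if P i then f (σ i) else 0 : ℂ)‖ ^ (2 : ENNReal).toReal ≤
        ‖f‖ ^ (2 : ENNReal).toReal := fun f s => by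
    refine le_trans ?_ (lp.sum_rpow_le_norm_rpow (by simp) f (s.image σ))
    rw [Finset.sum_image fun _ _ _ _ h => hσ h]
    refine Finset.sum_le_sum fun i _ => ?_
    split_ifs
    · rfl
    · simp
  LinearMap.mkContinuous
    { toFun := fun f => ⟨fun i => if P i then f (σ i) else 0, memℓp_gen' (hs f)⟩
      map_add' := fun f g => by
        ext i
        change (if P i then (f + g : L2Space α) (σ i) else 0) =
          (if P i then f (σ i) else 0) + if P i then g (σ i) else 0
        by_cases h : P i <;> simp [h]
      map_smul' := fun r f => by
        ext i
        by_cases h : P i <;> simp [h] } 1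
    (fun f => by
      rw [one_mul]
      exact lp.norm_le_of_forall_sum_le (by simp) (norm_nonneg _) (hs f))

open Classical in
theorem partialComp_apply {σ : α → α} (hσ : Function.Injective σ) (P : α → Prop)
    (f : L2Space α) (i : α) : partialComp hσ P f i = if P i then f (σ i) else 0 := rfl

open Classical in
/-- The basis vectors of `ℓ²`. -/
noncomputable def basisVec (i : α) : L2Space α := lp.single 2 i 1

open Classical in
theorem basisVec_apply (i j : α) : basisVec i j = if j = i then 1 else 0 := by
  rw [basisVec, lp.single_apply, Pi.single_apply]

theorem inner_basisVec (i : α) (f : L2Space α) : inner ℂ (basisVec i) f = f i := by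
  classical
  rw [basisVec, lp.inner_single_left]
  simp

open Classical in
theorem adjoint_partialComp_basisVec {σ : α → α} (hσ : Function.Injective σ) (P : α → Prop)
    (i : α) : (partialComp hσ P).adjoint (basisVec i) = if P i then basisVec (σ i) else 0 := by
  refine ext_inner_right ℂ fun f => ?_
  rw [ContinuousLinearMap.adjoint_inner_left, inner_basisVec, partialComp_apply]
  split_ifs
  · rw [inner_basisVec]
  · rw [inner_zero_left]

open Classical in
theorem partialComp_basisVec {σ : α → α} (hσ : Function.Injective σ) (P : α → Prop)
    (i : α) : partialComp hσ P (basisVec (σ i)) = if P i then basisVec i else 0 := by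
  ext j
  rw [partialComp_apply, basisVec_apply]
  by_cases hj : j = i
  · subst hj
    by_cases h : P j <;> simp [h, basisVec_apply]
  · have : ¬ σ j = σ i := fun h => hj (hσ h)
    by_cases h : P i <;> simp [h, basisVec_apply, this, hj]

theorem partialComp_basisVec_of_notMem_range {σ : α → α} (hσ : Function.Injective σ)
    (P : α → Prop) {i : α} (hi : ∀ j, σ j ≠ i) : partialComp hσ P (basisVec i) = 0 := by
  classical
  ext j
  rw [partialComp_apply, basisVec_apply, if_neg (hi j)]
  simp

variable (o : α)

/-- The vector state of a basis vector. -/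
noncomputable def vectorState : (L2Space α →L[ℂ] L2Space α) →ₗ[ℂ] ℂ where
  toFun a := a (basisVec o) o
  map_add' _ _ := rfl
  map_smul' _ _ := rfl

theorem vectorState_apply (a : L2Space α →L[ℂ] L2Space α) :
    vectorState o a = a (basisVec o) o := rfl

open scoped ComplexOrder in
theorem isCondExp_vectorState :
    IsCondExp (StarAlgHom.ofId ℂ (L2Space α →L[ℂ] L2Space α)) (vectorState o) where
  map_incl z := by
    rw [StarAlgHom.ofId_apply, Algebra.algebraMap_eq_smul_one, vectorState_apply]
    simp [basisVec_apply]
  map_bimod z a z' := by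
    rw [StarAlgHom.ofId_apply, StarAlgHom.ofId_apply, Algebra.algebraMap_eq_smul_one,
      Algebra.algebraMap_eq_smul_one, smul_one_mul, mul_smul_one, map_smul, map_smul]
    simp only [smul_eq_mul]
    ring
  map_nonneg a := by
    rw [vectorState_apply, ← inner_basisVec, mul_apply_eq_comp,
      ContinuousLinearMap.star_eq_adjoint, ContinuousLinearMap.adjoint_inner_right]
    exact Complex.nonneg_iff.2 ⟨inner_self_nonneg (𝕜 := ℂ), (inner_self_im (𝕜 := ℂ) _).symm⟩

end Shift

/-! ## Free variables with distributions `pathMeasure k` and `pathMeasure l` -/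

section Fock

variable (K : Fin 2 → ℕ)

/-- The index set of the basis of the Fock space: words in two letters. -/
abbrev FockIndex : Type u := ULift.{u} (List (Fin 2 × Unit))

/-- Adding a letter to a word. -/
def addLetter (c : Fin 2) (w : FockIndex.{u}) : FockIndex.{u} := ⟨(c, ()) :: w.down⟩

theorem addLetter_injective (c : Fin 2) : Function.Injective (addLetter.{u} c) := by
  rintro ⟨w⟩ ⟨w'⟩ h
  simpa [addLetter] using h

/-- The operator on the Fock space which removes a letter of colour `c`, if it does not belong to
a run that is too long. -/
noncomputable def fockAnnihilate (c : Fin 2) :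
    L2Space FockIndex.{u} →L[ℂ] L2Space FockIndex.{u} :=
  partialComp (addLetter_injective c) fun w => runDepth c w.down < K c

/-- The self-adjoint variables on the Fock space. -/
noncomputable def fockVar (c : Fin 2) : L2Space FockIndex.{u} →L[ℂ] L2Space FockIndex.{u} :=
  fockAnnihilate K c + star (fockAnnihilate K c)

theorem isSelfAdjoint_fockVar (c : Fin 2) : IsSelfAdjoint (fockVar.{u} K c) :=
  IsSelfAdjoint.add_star_self (fockAnnihilate.{u} K c)

/-- The basis vector of the word `c ⋯ c w` with `m` letters `c` before `w`. -/
noncomputable def runVec (c : Fin 2) (w : List (Fin 2 × Unit)) (m : ℕ) : L2Space FockIndex.{u} :=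
  basisVec ⟨monoWord c (List.replicate m ()) ++ w⟩

variable {K}

/-- As `w` does not begin with `c`, the run has exactly `m` letters, and the variable moves along a
path of `K c` vertices. -/
theorem fockVar_runVec {c : Fin 2} {w : List (Fin 2 × Unit)} (hw : ∀ x ∈ w.head?, x.1 ≠ c)
    {m : ℕ} (hm : m < K c) : fockVar.{u} K c (runVec c w m) =
      (if m + 1 < K c then runVec c w (m + 1) else 0) +
        if 1 ≤ m then runVec c w (m - 1) else 0 := by
  classical
  have hdep : ∀ m, runDepth c (monoWord c (List.replicate m ()) ++ w) = m + 1 := fun m => by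
    rw [runDepth_monoWord_append c _ hw, List.length_replicate]
  have h1 : star (fockAnnihilate.{u} K c) (runVec c w m) =
      if m + 1 < K c then runVec c w (m + 1) else 0 := by
    rw [ContinuousLinearMap.star_eq_adjoint, fockAnnihilate, runVec, adjoint_partialComp_basisVec]
    simp only [hdep]
    rfl
  have h2 : fockAnnihilate.{u} K c (runVec c w m) = if 1 ≤ m then runVec c w (m - 1) else 0 := by
    cases m with
    | zero =>
      rw [if_neg (by omega), fockAnnihilate, runVec, partialComp_basisVec_of_notMem_range]
      rintro ⟨v⟩ hv
      have hv' : (c, ()) :: v = w := by simpa [addLetter, monoWord] using hv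
      subst hv'
      exact hw (c, ()) (by simp) rfl
    | succ m =>
      rw [if_pos (by omega), fockAnnihilate]
      have e : runVec.{u} c w (m + 1) =
        basisVec (addLetter c ⟨monoWord c (List.replicate m ()) ++ w⟩) := rfl
      rw [e, partialComp_basisVec, if_pos (by rw [hdep]; exact hm)]
      rfl
  rw [fockVar, add_apply, h1, h2, add_comm]

variable (K) in
/-- The span of the words with at most `K c` letters `c` before `w`. -/
noncomputable def runEmb (c : Fin 2) (w : List (Fin 2 × Unit)) :
    (Fin (K c) → ℂ) →ₗ[ℂ] L2Space FockIndex.{u} :=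
  Fintype.linearCombination ℂ fun m => runVec c w m

theorem runEmb_single (c : Fin 2) (w : List (Fin 2 × Unit)) (m : Fin (K c)) :
    runEmb.{u} K c w (Pi.single m 1) = runVec c w m := by
  rw [runEmb, Fintype.linearCombination_apply_single, one_smul]

theorem fockVar_runEmb {c : Fin 2} {w : List (Fin 2 × Unit)} (hw : ∀ x ∈ w.head?, x.1 ≠ c)
    (v : Fin (K c) → ℂ) :
    fockVar.{u} K c (runEmb K c w v) = runEmb K c w ((pathMatrix (K c)).mulVec v) := by
  have : (fockVar.{u} K c).toLinearMap ∘ₗ runEmb K c w =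
      runEmb K c w ∘ₗ (pathMatrix (K c)).mulVecLin := by
    refine LinearMap.pi_ext' fun m => LinearMap.ext_ring ?_
    simp only [LinearMap.comp_apply, LinearMap.single_apply, Matrix.mulVecLin_apply,
      ContinuousLinearMap.coe_coe, runEmb_single]
    rw [fockVar_runVec hw m.2, pathMatrix_mulVec_single]
    have e : (fun j : Fin (K c) => (if (j : ℕ) = m + 1 then (1 : ℂ) else 0) +
        if (j : ℕ) + 1 = m then 1 else 0) =
        (if h : (m : ℕ) + 1 < K c then Pi.single ⟨m + 1, h⟩ 1 else 0) +
        if 1 ≤ (m : ℕ) then Pi.single ⟨m - 1, by omega⟩ 1 else 0 := by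
      funext j
      rw [Pi.add_apply]
      congr 1
      · split_ifs with h1 h2 h3
        · simp [← h1]
        · omega
        · rw [Pi.single_eq_of_ne]
          simpa [Fin.ext_iff] using h1
        · rfl
      · split_ifs with h1 h2 h3
        · simp [← h1]
        · omega
        · rw [Pi.single_eq_of_ne]
          simp only [ne_eq, Fin.ext_iff]
          omega
        · rfl
    rw [e, map_add]
    congr 1
    · split_ifs
      · rw [runEmb_single]
      · rw [map_zero]
    · split_ifs
      · rw [runEmb_single]
      · rw [map_zero]
  exact LinearMap.congr_fun this v

/-- The point is that `N` does not depend on `w`: what a polynomial does above the vacuum, it does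
above every word not beginning with `c`. -/
theorem exists_matrix_of_mem_adjoin {c : Fin 2}
    {a : L2Space FockIndex.{u} →L[ℂ] L2Space FockIndex.{u}}
    (ha : a ∈ Algebra.adjoin ℂ
      (Set.range (StarAlgHom.ofId ℂ (L2Space FockIndex.{u} →L[ℂ] L2Space FockIndex.{u})) ∪
        {fockVar K c})) :
    ∃ N : Module.End ℂ (Fin (K c) → ℂ), ∀ w : List (Fin 2 × Unit),
      (∀ x ∈ w.head?, x.1 ≠ c) → ∀ v, a (runEmb K c w v) = runEmb K c w (N v) := by
  have hscalar : ∀ r : ℂ, ∃ N : Module.End ℂ (Fin (K c) → ℂ), ∀ w : List (Fin 2 × Unit),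
      (∀ x ∈ w.head?, x.1 ≠ c) → ∀ v,
        (algebraMap ℂ (L2Space FockIndex.{u} →L[ℂ] L2Space FockIndex.{u}) r) (runEmb K c w v) =
          runEmb K c w (N v) := fun r => ⟨r • 1, fun w _ v => by
    rw [Algebra.algebraMap_eq_smul_one]
    simp⟩
  induction ha using Algebra.adjoin_induction with
  | mem a ha =>
    rcases ha with ⟨r, rfl⟩ | rfl
    · exact hscalar r
    · exact ⟨(pathMatrix (K c)).mulVecLin, fun w hw v => fockVar_runEmb hw v⟩
  | algebraMap r => exact hscalar r
  | add a a' _ _ h h' =>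
    obtain ⟨N, hN⟩ := h
    obtain ⟨N', hN'⟩ := h'
    exact ⟨N + N', fun w hw v => by
      rw [add_apply, hN w hw, hN' w hw, LinearMap.add_apply, map_add]⟩
  | mul a a' _ _ h h' =>
    obtain ⟨N, hN⟩ := h
    obtain ⟨N', hN'⟩ := h'
    exact ⟨N * N', fun w hw v => by
      rw [mul_apply_eq_comp, hN' w hw, hN w hw, Module.End.mul_apply]⟩

/-- The vacuum state. -/
noncomputable def fockState : (L2Space FockIndex.{u} →L[ℂ] L2Space FockIndex.{u}) →ₗ[ℂ] ℂ :=
  vectorState ⟨[]⟩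

theorem runEmb_nil_apply_vacuum {c : Fin 2} (hK : 0 < K c) (v : Fin (K c) → ℂ) :
    runEmb.{u} K c [] v ⟨[]⟩ = v ⟨0, hK⟩ := by
  rw [← inner_basisVec, runEmb, Fintype.linearCombination_apply, inner_sum,
    Finset.sum_eq_single ⟨0, hK⟩]
  · rw [inner_smul_right, inner_basisVec, runVec, basisVec_apply]
    simp [monoWord]
  · intro m _ hm
    have hm' : (m : ℕ) ≠ 0 := fun h => hm (Fin.ext h)
    rw [inner_smul_right, inner_basisVec, runVec, basisVec_apply]
    simp [monoWord, hm']
  · simp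

theorem fockState_fockVar_pow {c : Fin 2} (hK : 0 < K c) (n : ℕ) :
    fockState.{u} (fockVar K c ^ n) = (pathMatrix (K c) ^ n) ⟨0, hK⟩ ⟨0, hK⟩ := by
  have h : ∀ v : Fin (K c) → ℂ, (fockVar.{u} K c ^ n) (runEmb K c [] v) =
      runEmb K c [] ((pathMatrix (K c) ^ n).mulVec v) := by
    induction n with
    | zero => simp
    | succ n ih =>
      intro v
      rw [pow_succ, mul_apply_eq_comp, fockVar_runEmb (by simp), ih, Matrix.mulVec_mulVec,
        ← pow_succ]
  have h0 : basisVec ⟨[]⟩ = runEmb.{u} K c [] (Pi.single ⟨0, hK⟩ 1) := by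
    rw [runEmb_single]
    rfl
  rw [fockState, vectorState_apply, h0, h, runEmb_nil_apply_vacuum hK]
  simp [Matrix.mulVec_single]

/-- The span of the words which begin with `c`. -/
noncomputable def headSpan (c : Fin 2) : Submodule ℂ (L2Space FockIndex.{u}) :=
  Submodule.span ℂ {ξ | ∃ t, ξ = basisVec ⟨(c, ()) :: t⟩}

theorem headSpan_apply_vacuum {c : Fin 2} {ξ : L2Space FockIndex.{u}} (h : ξ ∈ headSpan c) :
    ξ ⟨[]⟩ = 0 := by
  classical
  refine Submodule.span_induction (p := fun ξ _ => ξ ⟨[]⟩ = 0) ?_ ?_ ?_ ?_ h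
  · rintro _ ⟨t, rfl⟩
    rw [basisVec_apply]
    simp
  · rfl
  · intro x y _ _ hx hy
    rw [lp.coeFn_add, Pi.add_apply, hx, hy, add_zero]
  · intro r x _ hx
    rw [lp.coeFn_smul, Pi.smul_apply, hx, smul_zero]

/-- Being centred says that the `(0, 0)` entry of `N` is zero. The same `N` acts above `w`, so `w`
itself does not occur in the image and only words with at least one new letter `c` remain. -/
theorem mem_headSpan_of_centred {c : Fin 2} (hK : 0 < K c)
    {a : L2Space FockIndex.{u} →L[ℂ] L2Space FockIndex.{u}}
    (ha : a ∈ Algebra.adjoin ℂ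
      (Set.range (StarAlgHom.ofId ℂ (L2Space FockIndex.{u} →L[ℂ] L2Space FockIndex.{u})) ∪
        {fockVar K c})) (ha0 : fockState a = 0) {w : List (Fin 2 × Unit)}
    (hw : ∀ x ∈ w.head?, x.1 ≠ c) : a (basisVec ⟨w⟩) ∈ headSpan c := by
  obtain ⟨N, hN⟩ := exists_matrix_of_mem_adjoin ha
  have h0 : ∀ w, basisVec ⟨w⟩ = runEmb.{u} K c w (Pi.single ⟨0, hK⟩ 1) := fun w => by
    rw [runEmb_single]
    rfl
  rw [fockState, vectorState_apply, h0, hN [] (by simp), runEmb_nil_apply_vacuum hK] at ha0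
  rw [h0, hN w hw, runEmb, Fintype.linearCombination_apply]
  refine Submodule.sum_mem _ fun m _ => ?_
  rcases m with ⟨_ | m, hm⟩
  · rw [ha0, zero_smul]
    exact zero_mem _
  · exact Submodule.smul_mem _ _ (Submodule.subset_span ⟨_, rfl⟩)

/-- Applied to the vacuum from the right, each centred factor sends words headed by the other colour
to words headed by its own, so the result never has a vacuum component. -/
theorem areFree_fockVar (hK : ∀ c, 0 < K c) :
    AreFree (StarAlgHom.ofId ℂ (L2Space FockIndex.{u} →L[ℂ] L2Space FockIndex.{u})) fockState
      (fockVar K) := by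
  intro n i a ha ha0 hne
  suffices h : (List.ofFn a).prod (basisVec ⟨[]⟩) ∈ headSpan (i 0) from headSpan_apply_vacuum h
  induction n with
  | zero =>
    simpa using mem_headSpan_of_centred (hK _) (ha 0) (ha0 0) (by simp)
  | succ n ih =>
    have h := ih (fun j => i j.succ) (fun j => a j.succ) (fun j => ha _) (fun j => ha0 _)
      fun j => hne j.succ
    rw [List.ofFn_succ, List.prod_cons, mul_apply_eq_comp]
    refine Submodule.span_induction (p := fun ξ _ => a 0 ξ ∈ headSpan (i 0)) ?_ ?_ ?_ ?_ h
    · rintro _ ⟨t, rfl⟩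
      refine mem_headSpan_of_centred (hK _) (ha 0) (ha0 0) ?_
      simpa using (hne 0).symm
    · rw [map_zero]
      exact zero_mem _
    · intro x y _ _ hx hy
      rw [map_add]
      exact add_mem hx hy
    · intro r x _ hx
      rw [map_smul]
      exact Submodule.smul_mem _ _ hx

theorem exists_isFreeConvolution_pathMeasure {k l : ℕ} (hk : 0 < k) (hl : 0 < l) :
    ∃ ρ, IsFreeConvolution.{u} (pathMeasure k) (pathMeasure l) ρ := by
  have hK : ∀ c, 0 < (![k, l] : Fin 2 → ℕ) c := by
    rw [Fin.forall_fin_two]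
    exact ⟨hk, hl⟩
  have hφ := isCondExp_vectorState (⟨[]⟩ : FockIndex.{u})
  obtain ⟨ρ, hρ⟩ := exists_hasDistribution hφ
    ((isSelfAdjoint_fockVar.{u} ![k, l] 0).add (isSelfAdjoint_fockVar ![k, l] 1))
  refine ⟨ρ, L2Space FockIndex.{u} →L[ℂ] L2Space FockIndex.{u}, inferInstance, fockState,
    fockVar ![k, l], hφ, areFree_fockVar hK, isSelfAdjoint_fockVar _,
    ⟨isProbabilityMeasure_pathMeasure hk, fun n => ⟨integrable_pathMeasure _, ?_⟩⟩,
    ⟨isProbabilityMeasure_pathMeasure hl, fun n => ⟨integrable_pathMeasure _, ?_⟩⟩, hρ⟩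
  · rw [integral_pow_pathMeasure hk]
    exact fockState_fockVar_pow (hK 0) n
  · rw [integral_pow_pathMeasure hl]
    exact fockState_fockVar_pow (hK 1) n

end Fock

theorem mainTheorem7 (k l : ℕ) (hk : 1 ≤ k) (hl : 1 ≤ l) :
    (∀ {A : Type u} {B : Type v} [CStarAlgebra A] [CStarAlgebra B] [PartialOrder B]
        [StarOrderedRing B] (ι : B →⋆ₐ[ℂ] A) (E : A →ₗ[ℂ] B) (_ : IsCondExp ι E)
        (X : Fin 2 → A) (J : Fin 2 → JacobiParams B)
        (_ : ∀ i, IsJacobiSzego ι E (X i) (J i)) (_ : AreFree ι E X)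
        (_ : (J 0).HasDepth k) (_ : (J 1).HasDepth l)
        (d : ℕ) (ε : Fin d → Fin 2) (b : ℕ → B),
        E (ncMonomial ι (fun i => X (ε i)) b) =
            ∑ π ∈ TCNC.relDepth k l d with π.color = ε, π.moment J b ∧
          ∑ π : TCNC d with π.color = ε, π.moment J b =
            ∑ π ∈ TCNC.relDepth k l d with π.color = ε, π.moment J b) ∧
      (∃ ρ : MeasureTheory.Measure ℝ,
        IsFreeConvolution.{u} (pathMeasure k) (pathMeasure l) ρ) ∧
      ∀ ρ : MeasureTheory.Measure ℝ,
        IsFreeConvolution.{u} (pathMeasure k) (pathMeasure l) ρ →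
        ∀ n : ℕ, ((TCNC.pairings k l (2 * n)).card : ℝ) = ∫ t, t ^ (2 * n) ∂ρ := by
  refine ⟨?_, exists_isFreeConvolution_pathMeasure hk hl,
    fun ρ hρ n => card_pairings_eq_integral hk hl hρ (2 * n)⟩
  intro A B _ _ _ _ ι E hE X J hX hfree hJ0 hJ1 d ε b
  have h := sum_moment_eq_sum_relDepth (J := J) b hJ0 hJ1 ε
  exact ⟨(map_ncMonomial_eq_sum b hE hX hfree ε).trans h, h⟩
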